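/- Let $M$ be a smooth ($C^\infty$) manifold modelled on a real Banach space $\mathbb{E}$, let $k\ge 1$, and let $\pi_k:T^kM\to M$ be the tangent bundle of order $k$: the set of classes $[\gamma,x]_k$ of smooth curves $\gamma:(-\epsilon,\epsilon)\to M$ with $\gamma(0)=x$, two curves being identified when they have the same starting point and the same derivatives at $0$ up to order $k$. It is a smooth manifold with the charts $$\Psi_\alpha^k:\pi_k^{-1}(U_\alpha)\to\psi_\alpha(U_\alpha)\times\mathbb{E}^k,\qquad [\gamma,x]_k\mapsto\Big((\psi_\alpha\circ\gamma)(0),(\psi_\alpha\circ\gamma)'(0),\dots,\tfrac1{k!}(\psi_\alpha\circ\gamma)^{(k)}(0)\Big),$$ where $(U_\alpha,\psi_\alpha)$ runs over the smooth charts of $M$. Let $J$ be the endomorphism of $TT^kM$ which in each of these charts is $(u;y,\eta_1,\dots,\eta_k)\mapsto(u;0,y,\eta_1,\dots,\eta_{k-1})$. A connection map on $T^kM$ is a smooth vector bundle morphism $K=(\overset{1}{K},\dots,\overset{k}{K}):TT^kM\to\bigoplus_{i=1}^kTM$ covering $\pi_k$ such that $\overset{k}{K}\circ J^a=\overset{k-a}{K}$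 for $1\le a\le k-1$ and $\overset{k}{K}\circ J^k=\pi_{k*}$. Let $\nabla$ be a linear connection on $M$, that is, a vector bundle morphism $\nabla:TTM\to TM$ covering $TM\to M$ which in every smooth chart $(U_\alpha,\psi_\alpha)$ of $M$ has the form $(x,\xi;y,\eta)\mapsto(x,\eta+\Gamma_\alpha(x,\xi)y)$ with a smooth map $\Gamma_\alpha:\psi_\alpha(U_\alpha)\times\mathbb{E}\to L(\mathbb{E},\mathbb{E})$ that is linear in its second variable (the local component of $\nabla$). Define $\overset{1}{M}_\alpha(x,\xi_1)y=\Gamma_\alpha(x,\xi_1)y$ and, for $2\le a\le k$, $$\overset{a}{M}_\alpha(x,\xi_1,\dots,\xi_a)y=\frac1a\Big(\sum_{i=1}^a\partial_i\overset{a-1}{M}_\alpha(x,\xi_1,\dots,\xi_{a-1})(y,i\xi_i)+\overset{1}{M}_\alpha(x,\xi_1)\big[\overset{a-1}{M}_\alpha(x,\xi_1,\dots,\xi_{a-1})y\big]\Big),$$ where $\partial_i\overset{a-1}{M}_\alpha(\cdots)(y,i\xi_i)$ is the partial derivative of $\overset{a-1}{M}_\alpha$ with respect to its $i$-th variable ($x$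 being the first) in the direction $i\xi_i$, applied to $y$. Theorem. There exists a connection map $K$ on $T^kM$ whose local components are the $\overset{a}{M}_\alpha$: for every smooth chart $(U_\alpha,\psi_\alpha)$ of $M$ the maps $\overset{a}{M}_\alpha:\psi_\alpha(U_\alpha)\times\mathbb{E}^a\to L(\mathbb{E},\mathbb{E})$, $1\le a\le k$, are smooth, and in the charts induced by $\psi_\alpha$ one has, for $u=(x,\xi_1,\dots,\xi_k)$ and $1\le i\le k$, $$\overset{i}{K}_\alpha(u;y,\eta_1,\dots,\eta_k)=\Big(x,\ \eta_i+\overset{1}{M}_\alpha(x,\xi_1)\eta_{i-1}+\overset{2}{M}_\alpha(x,\xi_1,\xi_2)\eta_{i-2}+\dots+\overset{i}{M}_\alpha(x,\xi_1,\dots,\xi_i)y\Big).$$ -/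

import Mathlib

open Set Topology Manifold ContDiff

noncomputable section

namespace HigherTangent

section Calculus

variable {E : Type*} [NormedAddCommGroup E] [NormedSpace ℝ E] {k : ℕ}

/-- The polynomial curve `t ↦ u₀ + t u₁ + ⋯ + tᵏ uₖ`. -/
def polyCurve (u : Fin (k + 1) → E) (t : ℝ) : E := ∑ i : Fin (k + 1), t ^ (i : ℕ) • u i

/-- The Taylor coefficients `(c(0), c'(0), …, c⁽ᵏ⁾(0) / k!)`. -/
def taylorJet (k : ℕ) (c : ℝ → E) : Fin (k + 1) → E :=
  fun j => ((Nat.factorial j : ℕ) : ℝ)⁻¹ • iteratedDeriv j c 0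

theorem polyCurve_zero (u : Fin (k + 1) → E) : polyCurve u 0 = u 0 := by
  simp [polyCurve, Fin.sum_univ_succ]

theorem contDiff_polyCurve :
    ContDiff ℝ ∞ (fun q : (Fin (k + 1) → E) × ℝ => polyCurve q.1 q.2) := by
  unfold polyCurve; fun_prop

theorem contDiff_polyCurve_right (u : Fin (k + 1) → E) : ContDiff ℝ ∞ (polyCurve u) := by
  unfold polyCurve; fun_prop

theorem taylorJet_zero (c : ℝ → E) : taylorJet k c 0 = c 0 := by simp [taylorJet]

theorem taylorJet_polyCurve (u : Fin (k + 1) → E) : taylorJet k (polyCurve u) = u := by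
  funext j
  have h : iteratedDeriv j (polyCurve u) 0 = ((Nat.factorial j : ℕ) : ℝ) • u j := by
    unfold polyCurve
    rw [iteratedDeriv_fun_sum (fun i _ => by fun_prop)]
    rw [Finset.sum_eq_single j]
    · rw [iteratedDeriv_smul_const (f := fun t : ℝ => t ^ (j : ℕ)) (by fun_prop),
        iteratedDeriv_fun_pow_zero]
      simp
    · intro i _ hij
      rw [iteratedDeriv_smul_const (f := fun t : ℝ => t ^ (i : ℕ)) (by fun_prop),
        iteratedDeriv_fun_pow_zero, if_neg (by omega), Nat.cast_zero, zero_smul]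
    · simp
  simp [taylorJet, h, smul_smul, Nat.factorial_ne_zero]

theorem taylorJet_congr {c₁ c₂ : ℝ → E} (h : c₁ =ᶠ[𝓝 0] c₂) :
    taylorJet k c₁ = taylorJet k c₂ := by
  funext j
  simp only [taylorJet]
  rw [h.iteratedDeriv_eq]

theorem taylorJet_eq_iff {c₁ c₂ : ℝ → E} : taylorJet k c₁ = taylorJet k c₂ ↔
    ∀ j ≤ k, iteratedDeriv j c₁ 0 = iteratedDeriv j c₂ 0 := by
  constructor
  · intro h j hj
    have := congrFun h ⟨j, by omega⟩
    simp only [taylorJet] at this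
    exact smul_right_injective _ (by positivity) this
  · intro h
    funext j
    simp only [taylorJet]
    rw [h j (by omega)]

/-- The `k`-jet of `f ∘ c` depends only on the `k`-jet of `c`. -/
theorem taylorJet_comp {f : E → E} {c₁ c₂ : ℝ → E} (hf : ContDiffAt ℝ ∞ f (c₁ 0))
    (h₁ : ContDiffAt ℝ ∞ c₁ 0) (h₂ : ContDiffAt ℝ ∞ c₂ 0)
    (h : taylorJet k c₁ = taylorJet k c₂) :
    taylorJet k (f ∘ c₁) = taylorJet k (f ∘ c₂) := by
  have h0 : c₁ 0 = c₂ 0 := by simpa [taylorJet_zero] using congrFun h 0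
  rw [taylorJet_eq_iff] at h ⊢
  intro j hj
  have hF : ∀ i ≤ k, iteratedFDeriv ℝ i c₁ 0 = iteratedFDeriv ℝ i c₂ 0 := by
    intro i hi
    rw [iteratedFDeriv_eq_equiv_comp, iteratedFDeriv_eq_equiv_comp]
    simp [h i hi]
  rw [iteratedDeriv_eq_iteratedFDeriv, iteratedDeriv_eq_iteratedFDeriv,
    iteratedFDeriv_comp hf h₁ (i := j) (by exact_mod_cast le_top),
    iteratedFDeriv_comp (h0 ▸ hf) h₂ (i := j) (by exact_mod_cast le_top), ← h0]
  congr 1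
  simp only [FormalMultilinearSeries.taylorComp]
  refine Finset.sum_congr rfl fun c _ => ?_
  ext
  simp only [FormalMultilinearSeries.compAlongOrderedFinpartition_apply]
  congr 1
  funext m
  exact congrArg (fun A : ContinuousMultilinearMap ℝ (fun _ : Fin (c.partSize m) => ℝ) E =>
    A ((fun _ => 1) ∘ c.emb m)) (hF _ ((c.partSize_le m).trans hj))

theorem contDiffOn_partial {F : Type*} [NormedAddCommGroup F] [NormedSpace ℝ F]
    {U : Set (F × ℝ)} (hU : IsOpen U) (H : F × ℝ → E) (hH : ContDiffOn ℝ ∞ H U) (j : ℕ) :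
    ContDiffOn ℝ ∞ (fun q : F × ℝ => iteratedDeriv j (fun s => H (q.1, s)) q.2) U := by
  induction j with
  | zero => simpa using hH
  | succ j ih =>
    have h1 : ContDiffOn ℝ ∞ (fun q => fderiv ℝ
        (fun q : F × ℝ => iteratedDeriv j (fun s => H (q.1, s)) q.2) q ((0 : F), (1 : ℝ))) U :=
      (ih.fderiv_of_isOpen hU (m := ∞) (by simp)).clm_apply contDiffOn_const
    refine h1.congr fun q hq => ?_
    have hd := ((ih.contDiffAt (hU.mem_nhds hq)).differentiableAt (by simp)).hasFDerivAt
    have hl : HasDerivAt (fun s : ℝ => (q.1, s)) ((0 : F), (1 : ℝ)) q.2 :=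
      (hasDerivAt_const _ _).prodMk (hasDerivAt_id _)
    rw [iteratedDeriv_succ]
    exact (hd.comp_hasDerivAt (f := fun s : ℝ => (q.1, s)) q.2 hl).deriv

theorem fderiv_partial {F : Type*} [NormedAddCommGroup F] [NormedSpace ℝ F]
    {U : Set (F × ℝ)} (hU : IsOpen U) (j : ℕ) :
    ∀ (H : F × ℝ → E), ContDiffOn ℝ ∞ H U → ∀ q ∈ U, ∀ v : F,
    fderiv ℝ (fun u => iteratedDeriv j (fun s => H (u, s)) q.2) q.1 v =
      iteratedDeriv j (fun s => fderiv ℝ H (q.1, s) (v, 0)) q.2 := by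
  induction j with
  | zero =>
    intro H hH q hq v
    have hd := ((hH.contDiffAt (hU.mem_nhds hq)).differentiableAt (by simp)).hasFDerivAt
    have hl : HasFDerivAt (fun u : F => (u, q.2)) (ContinuousLinearMap.inl ℝ F ℝ) q.1 :=
      (hasFDerivAt_id q.1).prodMk (hasFDerivAt_const _ _)
    have := (HasFDerivAt.comp (f := fun u : F => (u, q.2)) q.1 hd hl).fderiv
    simp only [iteratedDeriv_zero]
    have e : (fun u => H (u, q.2)) = H ∘ (fun u => (u, q.2)) := rfl
    rw [e, this]
    simp
  | succ j ih =>
    intro H hH q hq v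
    have hD : ContDiffOn ℝ ∞ (fun q => fderiv ℝ H q ((0 : F), (1 : ℝ))) U :=
      (hH.fderiv_of_isOpen hU (m := ∞) (by simp)).clm_apply contDiffOn_const
    have hl : ∀ (u : F) (s : ℝ), HasDerivAt (fun s : ℝ => (u, s)) ((0 : F), (1 : ℝ)) s :=
      fun u s => (hasDerivAt_const _ _).prodMk (hasDerivAt_id _)
    have hder : ∀ p ∈ U, deriv (fun s => H (p.1, s)) p.2 = fderiv ℝ H p ((0 : F), (1 : ℝ)) := by
      intro p hp
      have hd := ((hH.contDiffAt (hU.mem_nhds hp)).differentiableAt (by simp)).hasFDerivAt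
      exact (hd.comp_hasDerivAt (f := fun s : ℝ => (p.1, s)) p.2 (hl _ _)).deriv
    have hnear : ∀ᶠ u in 𝓝 q.1, (u, q.2) ∈ U :=
      (Continuous.prodMk_left q.2).continuousAt.eventually (hU.mem_nhds hq)
    have hnear' : ∀ p ∈ U, ∀ᶠ s in 𝓝 p.2, (p.1, s) ∈ U := fun p hp =>
      (Continuous.prodMk_right p.1).continuousAt.eventually (hU.mem_nhds hp)
    have e1 : (fun u => iteratedDeriv (j + 1) (fun s => H (u, s)) q.2) =ᶠ[𝓝 q.1]
        (fun u => iteratedDeriv j (fun s => fderiv ℝ H (u, s) ((0 : F), (1 : ℝ))) q.2) := by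
      filter_upwards [hnear] with u hu
      rw [iteratedDeriv_succ']
      refine Filter.EventuallyEq.iteratedDeriv_eq _ ?_
      filter_upwards [hnear' (u, q.2) hu] with s hs
      exact hder (u, s) hs
    rw [e1.fderiv_eq, ih _ hD q hq v, iteratedDeriv_succ']
    refine Filter.EventuallyEq.iteratedDeriv_eq _ ?_
    filter_upwards [hnear' q hq] with s hs
    have hF : DifferentiableAt ℝ (fderiv ℝ H) (q.1, s) :=
      ((hH.contDiffAt (hU.mem_nhds hs)).fderiv_right (m := 1) (by decide)).differentiableAt
        (by simp)
    have hsym : IsSymmSndFDerivAt ℝ H (q.1, s) :=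
      (hH.contDiffAt (hU.mem_nhds hs)).isSymmSndFDerivAt (by simp; decide)
    have a1 : fderiv ℝ (fun q => fderiv ℝ H q ((0 : F), (1 : ℝ))) (q.1, s) (v, 0) =
        fderiv ℝ (fderiv ℝ H) (q.1, s) (v, 0) (0, 1) := by
      rw [(hF.hasFDerivAt.clm_apply (hasFDerivAt_const _ _)).fderiv]; simp
    have a2 : deriv (fun s => fderiv ℝ H (q.1, s) (v, 0)) s =
        fderiv ℝ (fderiv ℝ H) (q.1, s) (0, 1) (v, 0) := by
      have := (hF.hasFDerivAt.comp_hasDerivAt (f := fun s : ℝ => (q.1, s)) s (hl _ _)).clm_apply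
        (hasDerivAt_const s (v, (0 : ℝ)))
      simpa using this.deriv
    rw [a1, a2]
    exact hsym _ _

/-- The local expression `u ↦` jet of `g ∘ (u₀ + t u₁ + ⋯ + tᵏ uₖ)` of a change of charts. -/
def jetMap (k : ℕ) (g : E → E) (u : Fin (k + 1) → E) : Fin (k + 1) → E :=
  taylorJet k (g ∘ polyCurve u)

theorem contDiffOn_jetMap {g : E → E} {s : Set E} (hs : IsOpen s) (hg : ContDiffOn ℝ ∞ g s) :
    ContDiffOn ℝ ∞ (jetMap k g) {u | u 0 ∈ s} := by
  set U : Set ((Fin (k + 1) → E) × ℝ) := {q | polyCurve q.1 q.2 ∈ s}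
  have hU : IsOpen U := hs.preimage contDiff_polyCurve.continuous
  have hH : ContDiffOn ℝ ∞ (fun q : (Fin (k + 1) → E) × ℝ => g (polyCurve q.1 q.2)) U :=
    hg.comp contDiff_polyCurve.contDiffOn fun q hq => hq
  refine contDiffOn_pi.2 fun j => ?_
  refine ContDiffOn.const_smul _ ?_
  refine (contDiffOn_partial hU _ hH j).comp (f := fun u => (u, (0 : ℝ)))
    (by fun_prop) ?_
  intro u hu
  simpa [U, polyCurve_zero] using hu

/-- The shift `(y, η₁, …, ηₖ) ↦ (0, y, η₁, …, ηₖ₋₁)`. -/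
def shift (E : Type*) [NormedAddCommGroup E] [NormedSpace ℝ E] (k : ℕ) :
    (Fin (k + 1) → E) →L[ℝ] (Fin (k + 1) → E) :=
  ContinuousLinearMap.pi (Fin.cons 0 fun i : Fin k => ContinuousLinearMap.proj i.castSucc)

theorem shift_zero (v : Fin (k + 1) → E) : shift E k v 0 = 0 := by simp [shift]

theorem shift_succ (v : Fin (k + 1) → E) (i : Fin k) : shift E k v i.succ = v i.castSucc := by
  simp [shift]

theorem polyCurve_shift (v : Fin (k + 1) → E) (t : ℝ) :
    polyCurve (shift E k v) t = t • polyCurve v t - t ^ (k + 1) • v (Fin.last k) := by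
  unfold polyCurve
  rw [Fin.sum_univ_succ, Fin.sum_univ_castSucc]
  simp [shift_zero, shift_succ, Finset.smul_sum, smul_smul, pow_succ', smul_add]

theorem iteratedDeriv_id_smul (j : ℕ) : ∀ (h : ℝ → E) (x : ℝ),
    (∀ᶠ y in 𝓝 x, ContDiffAt ℝ ∞ h y) →
    iteratedDeriv (j + 1) (fun t => t • h t) x =
      x • iteratedDeriv (j + 1) h x + ((j : ℝ) + 1) • iteratedDeriv j h x := by
  have key : ∀ (h : ℝ → E) (x : ℝ), ContDiffAt ℝ ∞ h x →
      deriv (fun t => t • h t) x = x • deriv h x + h x := by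
    intro h x hh
    simpa using ((hasDerivAt_id' x).fun_smul (hh.differentiableAt (by simp)).hasDerivAt).deriv
  induction j with
  | zero =>
    intro h x hh
    simpa using key h x hh.self_of_nhds
  | succ j ih =>
    intro h x hh
    have hd : ∀ᶠ y in 𝓝 x, ContDiffAt ℝ ∞ (deriv h) y := by
      filter_upwards [hh] with y hy
      have : ContDiffAt ℝ ∞ (fun y => fderiv ℝ h y 1) y :=
        (hy.fderiv_right (m := ∞) (by simp)).clm_apply contDiffAt_const
      simpa using this
    have e : deriv (fun t => t • h t) =ᶠ[𝓝 x] (fun t => t • deriv h t + h t) := by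
      filter_upwards [hh] with y hy using key h y hy
    have c1 : ContDiffAt ℝ ∞ (fun t => t • deriv h t) x := contDiffAt_id.smul hd.self_of_nhds
    have c2 := hh.self_of_nhds
    rw [iteratedDeriv_succ', e.iteratedDeriv_eq,
      iteratedDeriv_fun_add (c1.of_le (by exact_mod_cast le_top))
        (c2.of_le (by exact_mod_cast le_top)), ih _ _ hd, ← iteratedDeriv_succ',
      ← iteratedDeriv_succ']
    push_cast
    module

theorem iteratedDeriv_pow_smul (h : ℝ → E) (hh : ∀ᶠ y in 𝓝 0, ContDiffAt ℝ ∞ h y) (m : ℕ) :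
    ∀ j < m, iteratedDeriv j (fun t => t ^ m • h t) 0 = 0 := by
  induction m with
  | zero => intro j hj; omega
  | succ m ih =>
    intro j hj
    cases j with
    | zero => simp
    | succ j =>
      have e : (fun t : ℝ => t ^ (m + 1) • h t) = fun t => t • (t ^ m • h t) := by
        funext t; rw [smul_smul, pow_succ']
      have : ∀ᶠ y in 𝓝 (0 : ℝ), ContDiffAt ℝ ∞ (fun t => t ^ m • h t) y := by
        filter_upwards [hh] with y hy
        exact (contDiffAt_id.pow m).smul hy
      rw [e, iteratedDeriv_id_smul j _ _ this, ih j (by omega)]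
      simp

/-- The derivative of a change of charts of `TᵏM` commutes with the shift. -/
theorem fderiv_jetMap_shift {g : E → E} {s : Set E} (hs : IsOpen s) (hg : ContDiffOn ℝ ∞ g s)
    (u : Fin (k + 1) → E) (hu : u 0 ∈ s) (v : Fin (k + 1) → E) :
    fderiv ℝ (jetMap k g) u (shift E k v) = shift E k (fderiv ℝ (jetMap k g) u v) := by
  set U : Set ((Fin (k + 1) → E) × ℝ) := {q | polyCurve q.1 q.2 ∈ s}
  have hU : IsOpen U := hs.preimage contDiff_polyCurve.continuous
  have hH : ContDiffOn ℝ ∞ (fun q : (Fin (k + 1) → E) × ℝ => g (polyCurve q.1 q.2)) U :=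
    hg.comp contDiff_polyCurve.contDiffOn fun q hq => hq
  have hu0 : (u, (0 : ℝ)) ∈ U := by simpa [U, polyCurve_zero] using hu
  have hdiff : DifferentiableAt ℝ (jetMap k g) u :=
    ((contDiffOn_jetMap hs hg).contDiffAt
      ((hs.preimage (continuous_apply 0)).mem_nhds hu)).differentiableAt (by simp)
  have hnear : ∀ᶠ t in 𝓝 (0 : ℝ), polyCurve u t ∈ s :=
    (contDiff_polyCurve_right u).continuous.continuousAt.eventually
      (hs.mem_nhds (by simpa [polyCurve_zero] using hu))
  -- the derivative in terms of `t ↦ Dg(c(t)) (polyCurve w t)`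
  have hformula : ∀ (w : Fin (k + 1) → E) (j : Fin (k + 1)),
      fderiv ℝ (jetMap k g) u w j = ((Nat.factorial j : ℕ) : ℝ)⁻¹ •
        iteratedDeriv j (fun t => fderiv ℝ g (polyCurve u t) (polyCurve w t)) 0 := by
    intro w j
    have hj : DifferentiableAt ℝ (fun u => iteratedDeriv j (g ∘ polyCurve u) 0) u := by
      have := (contDiffOn_partial hU _ hH j).comp (f := fun u => (u, (0 : ℝ)))
        (s := {u | u 0 ∈ s}) (by fun_prop)
        (fun u hu => by simpa [U, polyCurve_zero] using hu)
      exact (this.contDiffAt ((hs.preimage (continuous_apply 0)).mem_nhds hu)).differentiableAt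
        (by simp)
    have h1 : fderiv ℝ (jetMap k g) u w j = fderiv ℝ (fun u => jetMap k g u j) u w := by
      rw [fderiv_apply hdiff j]; rfl
    have h2 : (fun u => jetMap k g u j) =
        fun u => ((Nat.factorial j : ℕ) : ℝ)⁻¹ • iteratedDeriv j (g ∘ polyCurve u) 0 := rfl
    rw [h1, h2, fderiv_fun_const_smul hj]
    simp only [smul_apply]
    congr 1
    have h3 := fderiv_partial hU j _ hH (u, 0) hu0 w
    refine h3.trans ?_
    refine Filter.EventuallyEq.iteratedDeriv_eq _ ?_
    filter_upwards [hnear] with t ht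
    have hgd := ((hg.contDiffAt (hs.mem_nhds ht)).differentiableAt (by simp)).hasFDerivAt
    have hp : HasFDerivAt (fun q : (Fin (k + 1) → E) × ℝ => polyCurve q.1 q.2)
        (fderiv ℝ (fun q : (Fin (k + 1) → E) × ℝ => polyCurve q.1 q.2) (u, t)) (u, t) :=
      ((contDiff_polyCurve.contDiffAt).differentiableAt (by simp)).hasFDerivAt
    have h4 := (HasFDerivAt.comp (f := fun q : (Fin (k + 1) → E) × ℝ => polyCurve q.1 q.2)
      (u, t) hgd hp).fderiv
    have h5 : fderiv ℝ (fun q : (Fin (k + 1) → E) × ℝ => polyCurve q.1 q.2) (u, t) (w, 0) =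
        polyCurve w t := by
      have hL : HasFDerivAt (fun r : ℝ => ((u, t) : (Fin (k + 1) → E) × ℝ) + r • (w, (0 : ℝ)))
          ((ContinuousLinearMap.id ℝ ℝ).smulRight (w, (0 : ℝ))) 0 := by
        simpa using ((hasFDerivAt_id (𝕜 := ℝ) (0 : ℝ)).smul_const (w, (0 : ℝ))).const_add
          ((u, t) : (Fin (k + 1) → E) × ℝ)
      have hp' : DifferentiableAt ℝ
          (fun q : (Fin (k + 1) → E) × ℝ => polyCurve q.1 q.2) (u, t) := hp.differentiableAt
      rw [← hp'.lineDeriv_eq_fderiv]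
      have : (fun r : ℝ => polyCurve (((u, t) : (Fin (k + 1) → E) × ℝ) + r • (w, (0 : ℝ))).1
          (((u, t) : (Fin (k + 1) → E) × ℝ) + r • (w, (0 : ℝ))).2) =
          fun r => polyCurve u t + r • polyCurve w t := by
        funext r
        simp only [polyCurve, Prod.fst_add, Prod.snd_add, Prod.smul_fst, Prod.smul_snd, smul_zero,
          add_zero, Pi.add_apply, Pi.smul_apply, smul_add, Finset.sum_add_distrib,
          Finset.smul_sum]
        congr 1
        exact Finset.sum_congr rfl fun i _ => smul_comm _ _ _
      rw [lineDeriv, this]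
      simpa using (((hasDerivAt_id (0 : ℝ)).smul_const (polyCurve w t)).const_add
        (polyCurve u t)).deriv
    have h6 := congrArg (fun A => A (w, (0 : ℝ))) h4
    simp only [ContinuousLinearMap.comp_apply] at h6
    rw [h5] at h6
    exact h6
  have hcurve : ∀ w : Fin (k + 1) → E, ∀ᶠ t in 𝓝 (0 : ℝ),
      ContDiffAt ℝ ∞ (fun t => fderiv ℝ g (polyCurve u t) (polyCurve w t)) t := by
    intro w
    filter_upwards [hnear] with t ht
    have hgd := (hg.contDiffAt (hs.mem_nhds ht)).fderiv_right (m := ∞) (by simp)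
    exact (hgd.comp t (contDiff_polyCurve_right u).contDiffAt).clm_apply
      (contDiff_polyCurve_right w).contDiffAt
  have hlast : ∀ᶠ t in 𝓝 (0 : ℝ),
      ContDiffAt ℝ ∞ (fun t => fderiv ℝ g (polyCurve u t) (v (Fin.last k))) t := by
    filter_upwards [hnear] with t ht
    have hgd := (hg.contDiffAt (hs.mem_nhds ht)).fderiv_right (m := ∞) (by simp)
    exact (hgd.comp t (contDiff_polyCurve_right u).contDiffAt).clm_apply contDiffAt_const
  set h := fun t => fderiv ℝ g (polyCurve u t) (polyCurve v t) with hdef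
  set l := fun t => fderiv ℝ g (polyCurve u t) (v (Fin.last k)) with ldef
  have hshift : ∀ j : ℕ, j < k + 1 →
      iteratedDeriv j (fun t => fderiv ℝ g (polyCurve u t) (polyCurve (shift E k v) t)) 0 =
        iteratedDeriv j (fun t => t • h t) 0 := by
    intro j hj
    have e : (fun t => fderiv ℝ g (polyCurve u t) (polyCurve (shift E k v) t)) =
        fun t => t • h t - t ^ (k + 1) • l t := by
      funext t
      simp [polyCurve_shift, hdef, ldef]
    have d1 : ContDiffAt ℝ j (fun t => t • h t) 0 :=
      (contDiffAt_id.smul (hcurve v).self_of_nhds).of_le (by exact_mod_cast le_top)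
    have d2 : ContDiffAt ℝ j (fun t => t ^ (k + 1) • l t) 0 :=
      ((contDiffAt_id.pow _).smul hlast.self_of_nhds).of_le (by exact_mod_cast le_top)
    rw [e, iteratedDeriv_fun_sub d1 d2,
      iteratedDeriv_pow_smul l hlast _ j hj, sub_zero]
  funext j
  rw [hformula, hshift j j.2]
  refine Fin.cases ?_ (fun i => ?_) j
  · simp [shift_zero]
  · rw [shift_succ, hformula]
    simp only [Fin.val_succ, Fin.val_castSucc]
    rw [iteratedDeriv_id_smul _ _ _ (hcurve v), zero_smul, zero_add, smul_smul,
      Nat.factorial_succ]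
    congr 1
    push_cast
    field_simp

end Calculus

section Manifold

variable {E : Type*} [NormedAddCommGroup E] [NormedSpace ℝ E]
  {M : Type*} [TopologicalSpace M] [ChartedSpace E M] {k : ℕ}

variable (E M) in
/-- Smooth curves `γ : (-ε, ε) → M` for some `ε > 0`; the values of the underlying function
outside `(-ε, ε)` play no role. -/
structure SmoothCurve where
  toFun : ℝ → M
  smooth : ∃ ε > 0, ContMDiffOn 𝓘(ℝ, ℝ) 𝓘(ℝ, E) ∞ toFun (Ioo (-ε) ε)

variable (E M k) in
/-- Two curves are `k`-equivalent if they start at the same point and have the same derivatives at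
`0` up to order `k`, in every chart of the maximal smooth atlas around that point. -/
def jetSetoid : Setoid (SmoothCurve E M) where
  r γ₁ γ₂ := γ₁.toFun 0 = γ₂.toFun 0 ∧ ∀ e ∈ IsManifold.maximalAtlas 𝓘(ℝ, E) ∞ M, γ₁.toFun 0 ∈ e.source →
    ∀ j, 1 ≤ j → j ≤ k → iteratedDeriv j (e ∘ γ₁.toFun) 0 = iteratedDeriv j (e ∘ γ₂.toFun) 0
  iseqv :=
    { refl := fun γ => ⟨rfl, fun _ _ _ _ _ _ => rfl⟩
      symm := fun {γ₁ γ₂} h => ⟨h.1.symm, fun e he hs j h1 hj =>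
        (h.2 e he (by rw [h.1]; exact hs) j h1 hj).symm⟩
      trans := fun {γ₁ γ₂ γ₃} h h' => ⟨h.1.trans h'.1, fun e he hs j h1 hj =>
        (h.2 e he hs j h1 hj).trans (h'.2 e he (by rw [← h.1]; exact hs) j h1 hj)⟩ }

variable (E M k) in
/-- The tangent bundle `TᵏM` of order `k`: `k`-jets at `0` of smooth curves in `M`. -/
def OscBundle : Type _ := Quotient (jetSetoid E M k)

namespace OscBundle

/-- The class `[γ, γ(0)]ₖ`. -/
def mk (k : ℕ) (γ : SmoothCurve E M) : OscBundle E M k := Quotient.mk (jetSetoid E M k) γ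

/-- The canonical projection `πₖ : TᵏM → M`. -/
def proj (p : OscBundle E M k) : M :=
  Quotient.lift (s := jetSetoid E M k) (fun γ : SmoothCurve E M => γ.toFun 0)
    (fun _ _ h => h.1) p

@[simp] theorem proj_mk (γ : SmoothCurve E M) : proj (mk k γ) = γ.toFun 0 := rfl

/-- The coordinates `((ψ ∘ γ)(0), (ψ ∘ γ)'(0), …, (ψ ∘ γ)⁽ᵏ⁾(0) / k!)` of `[γ, γ(0)]ₖ` in the
chart `ψ = e`; by `coord_mk` they do not depend on the representative `γ`. -/
def coord (e : OpenPartialHomeomorph M E) (p : OscBundle E M k) : Fin (k + 1) → E :=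
  taylorJet k (e ∘ (Quotient.out p).toFun)

variable {e e' : OpenPartialHomeomorph M E}

theorem coord_mk (he : e ∈ IsManifold.maximalAtlas 𝓘(ℝ, E) ∞ M) (γ : SmoothCurve E M)
    (hγ : γ.toFun 0 ∈ e.source) : coord e (mk k γ) = taylorJet k (e ∘ γ.toFun) := by
  have h : (jetSetoid E M k) (Quotient.out (mk k γ)) γ := Quotient.mk_out (s := jetSetoid E M k) γ
  unfold coord
  rw [taylorJet_eq_iff]
  intro j hj
  rcases Nat.eq_zero_or_pos j with rfl | h1
  · simp [h.1]
  · exact h.2 e he (by rw [h.1]; exact hγ) j h1 hj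

theorem contMDiffAt_curve (γ : SmoothCurve E M) :
    ContMDiffAt 𝓘(ℝ, ℝ) 𝓘(ℝ, E) ∞ γ.toFun 0 := by
  obtain ⟨ε, hε, h⟩ := γ.smooth
  exact h.contMDiffAt (Ioo_mem_nhds (by linarith) hε)

theorem continuousAt_curve (γ : SmoothCurve E M) : ContinuousAt γ.toFun 0 :=
  (contMDiffAt_curve γ).continuousAt

theorem contDiffAt_chart_curve (he : e ∈ IsManifold.maximalAtlas 𝓘(ℝ, E) ∞ M)
    (γ : SmoothCurve E M) (hγ : γ.toFun 0 ∈ e.source) : ContDiffAt ℝ ∞ (e ∘ γ.toFun) 0 :=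
  ((contMDiffAt_of_mem_maximalAtlas he hγ).comp 0 (contMDiffAt_curve γ)).contDiffAt

theorem contDiffOn_transition (he : e ∈ IsManifold.maximalAtlas 𝓘(ℝ, E) ∞ M)
    (he' : e' ∈ IsManifold.maximalAtlas 𝓘(ℝ, E) ∞ M) :
    ContDiffOn ℝ ∞ (e' ∘ e.symm) (e.symm.trans e').source := by
  have h1 := contMDiffOn_symm_of_mem_maximalAtlas he
  have h2 := contMDiffOn_of_mem_maximalAtlas he'
  refine (h2.comp (h1.mono ?_) ?_).contDiffOn
  · intro x hx
    simp at hx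
    exact hx.1
  · intro x hx
    simp at hx
    exact hx.2

theorem contMDiffOn_polyCurve (he : e ∈ IsManifold.maximalAtlas 𝓘(ℝ, E) ∞ M)
    (u : Fin (k + 1) → E) (hu : u 0 ∈ e.target) :
    ∃ ε > 0, ContMDiffOn 𝓘(ℝ, ℝ) 𝓘(ℝ, E) ∞ (e.symm ∘ polyCurve u) (Ioo (-ε) ε) := by
  have hc := (contDiff_polyCurve_right u).continuous
  have : polyCurve u ⁻¹' e.target ∈ 𝓝 (0 : ℝ) :=
    hc.continuousAt.preimage_mem_nhds (e.open_target.mem_nhds (by rwa [polyCurve_zero]))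
  obtain ⟨ε, hε, h⟩ := Metric.mem_nhds_iff.1 this
  rw [Real.ball_eq_Ioo, zero_sub, zero_add] at h
  exact ⟨ε, hε, (contMDiffOn_symm_of_mem_maximalAtlas he).comp
    (contDiff_polyCurve_right u).contMDiff.contMDiffOn h⟩

theorem coord_zero (he : e ∈ IsManifold.maximalAtlas 𝓘(ℝ, E) ∞ M) (p : OscBundle E M k)
    (hp : proj p ∈ e.source) : coord e p 0 = e (proj p) := by
  induction p using Quotient.inductionOn with
  | h γ =>
    have := coord_mk (k := k) he γ hp
    rw [show (⟦γ⟧ : Quotient (jetSetoid E M k)) = mk k γ from rfl, this, taylorJet_zero]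
    rfl

/-- A curve is determined up to `k`-equivalence by its Taylor coefficients in one chart. -/
theorem mk_eq_of_taylorJet_eq (he : e ∈ IsManifold.maximalAtlas 𝓘(ℝ, E) ∞ M)
    (γ₁ γ₂ : SmoothCurve E M) (h₁ : γ₁.toFun 0 ∈ e.source) (h₂ : γ₂.toFun 0 ∈ e.source)
    (h : taylorJet k (e ∘ γ₁.toFun) = taylorJet k (e ∘ γ₂.toFun)) : mk k γ₁ = mk k γ₂ := by
  have h0 : γ₁.toFun 0 = γ₂.toFun 0 := by
    have := congrFun h 0
    simp only [taylorJet_zero, Function.comp_apply] at this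
    exact e.injOn h₁ h₂ this
  refine Quotient.sound ⟨h0, fun e' he' hs j _ hj => ?_⟩
  have key : ∀ γ : SmoothCurve E M, γ.toFun 0 ∈ e.source →
      taylorJet k (e' ∘ γ.toFun) = taylorJet k ((e' ∘ e.symm) ∘ (e ∘ γ.toFun)) := by
    intro γ hγ
    refine taylorJet_congr ?_
    filter_upwards [(continuousAt_curve γ).eventually (e.open_source.mem_nhds hγ)] with t ht
    simp [e.left_inv ht]
  have hg : ContDiffAt ℝ ∞ (e' ∘ e.symm) ((e ∘ γ₁.toFun) 0) := by
    refine (contDiffOn_transition he he').contDiffAt ((e.symm.trans e').open_source.mem_nhds ?_)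
    simp [h₁, hs]
  have := taylorJet_comp hg (contDiffAt_chart_curve he γ₁ h₁) (contDiffAt_chart_curve he γ₂ h₂) h
  rw [← key γ₁ h₁, ← key γ₂ h₂, taylorJet_eq_iff] at this
  exact this j hj

open Classical in
/-- The class of the curve `t ↦ ψ⁻¹(u₀ + t u₁ + ⋯ + tᵏ uₖ)` for `u₀` in the image of `ψ = e`. -/
def ofCoord (he : e ∈ IsManifold.maximalAtlas 𝓘(ℝ, E) ∞ M) (u : Fin (k + 1) → E) :
    OscBundle E M k :=
  if hu : u 0 ∈ e.target then mk k ⟨e.symm ∘ polyCurve u, contMDiffOn_polyCurve he u hu⟩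
  else mk k ⟨fun _ => e.symm (u 0), 1, one_pos, contMDiffOn_const⟩

theorem ofCoord_of_mem (he : e ∈ IsManifold.maximalAtlas 𝓘(ℝ, E) ∞ M) (u : Fin (k + 1) → E)
    (hu : u 0 ∈ e.target) :
    ofCoord he u = mk k ⟨e.symm ∘ polyCurve u, contMDiffOn_polyCurve he u hu⟩ := dif_pos hu

theorem proj_ofCoord (he : e ∈ IsManifold.maximalAtlas 𝓘(ℝ, E) ∞ M) (u : Fin (k + 1) → E)
    (hu : u 0 ∈ e.target) : proj (ofCoord he u) = e.symm (u 0) := by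
  rw [ofCoord_of_mem he u hu]
  simp [polyCurve_zero]

theorem coord_ofCoord' (he : e ∈ IsManifold.maximalAtlas 𝓘(ℝ, E) ∞ M)
    (he' : e' ∈ IsManifold.maximalAtlas 𝓘(ℝ, E) ∞ M) (u : Fin (k + 1) → E)
    (hu : u 0 ∈ e.target) (hu' : e.symm (u 0) ∈ e'.source) :
    coord e' (ofCoord he u) = jetMap k (e' ∘ e.symm) u := by
  rw [ofCoord_of_mem he u hu, coord_mk he' _ (by simpa [polyCurve_zero] using hu')]
  rfl

theorem coord_ofCoord (he : e ∈ IsManifold.maximalAtlas 𝓘(ℝ, E) ∞ M) (u : Fin (k + 1) → E)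
    (hu : u 0 ∈ e.target) : coord e (ofCoord he u) = u := by
  rw [coord_ofCoord' he he u hu (e.map_target hu)]
  have : jetMap k (e ∘ e.symm) u = taylorJet k (polyCurve u) := by
    refine taylorJet_congr ?_
    have h0 : polyCurve u 0 ∈ e.target := by rwa [polyCurve_zero]
    filter_upwards [(contDiff_polyCurve_right u).continuous.continuousAt.eventually
      (e.open_target.mem_nhds h0)] with t ht
    simp [e.right_inv ht]
  rw [this, taylorJet_polyCurve]

theorem ofCoord_coord (he : e ∈ IsManifold.maximalAtlas 𝓘(ℝ, E) ∞ M) (p : OscBundle E M k)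
    (hp : proj p ∈ e.source) : ofCoord he (coord e p) = p := by
  have h0 : coord e p 0 ∈ e.target := by rw [coord_zero he p hp]; exact e.map_source hp
  have h1 : e.symm (coord e p 0) ∈ e.source := e.map_target h0
  have h2 := coord_ofCoord he _ h0
  rw [ofCoord_of_mem he _ h0] at h2 ⊢
  rw [coord_mk he _ (by simpa [polyCurve_zero] using h1)] at h2
  clear h1
  revert h2 h0
  induction p using Quotient.inductionOn with
  | h γ =>
    intro h0 h2
    refine mk_eq_of_taylorJet_eq he _ γ ?_ hp ?_
    · simpa [polyCurve_zero] using e.map_target h0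
    · exact h2.trans (coord_mk (k := k) he γ hp)

/-- `Ψ : πₖ⁻¹(U) → ψ(U) × Eᵏ` for a chart `(U, ψ)` of `M`, as a partial equivalence. -/
def jetPartialEquiv (k : ℕ) (he : e ∈ IsManifold.maximalAtlas 𝓘(ℝ, E) ∞ M) :
    PartialEquiv (OscBundle E M k) (Fin (k + 1) → E) where
  toFun := coord e
  invFun := ofCoord he
  source := {p | proj p ∈ e.source}
  target := {u | u 0 ∈ e.target}
  map_source' p hp := by
    simp only [mem_ofPred_eq] at hp ⊢
    rw [coord_zero he p hp]; exact e.map_source hp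
  map_target' u hu := by
    simp only [mem_ofPred_eq] at hu ⊢
    rw [proj_ofCoord he u hu]; exact e.map_target hu
  left_inv' p hp := ofCoord_coord he p hp
  right_inv' u hu := coord_ofCoord he u hu

theorem jetPartialEquiv_trans_source (he : e ∈ IsManifold.maximalAtlas 𝓘(ℝ, E) ∞ M)
    (he' : e' ∈ IsManifold.maximalAtlas 𝓘(ℝ, E) ∞ M) :
    ((jetPartialEquiv k he).symm.trans (jetPartialEquiv k he')).source =
      {u | u 0 ∈ (e.symm.trans e').source} := by
  ext u
  simp only [PartialEquiv.trans_source, PartialEquiv.symm_source, mem_inter_iff, mem_preimage,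
    mem_ofPred_eq, OpenPartialHomeomorph.trans_source, OpenPartialHomeomorph.symm_source]
  refine and_congr_right fun hu => ?_
  change proj (ofCoord he u) ∈ e'.source ↔ _
  rw [proj_ofCoord he u hu]

theorem contDiffOn_jetPartialEquiv_trans (he : e ∈ IsManifold.maximalAtlas 𝓘(ℝ, E) ∞ M)
    (he' : e' ∈ IsManifold.maximalAtlas 𝓘(ℝ, E) ∞ M) :
    ContDiffOn ℝ ∞ ((jetPartialEquiv k he).symm.trans (jetPartialEquiv k he'))
      ((jetPartialEquiv k he).symm.trans (jetPartialEquiv k he')).source := by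
  rw [jetPartialEquiv_trans_source he he']
  refine (contDiffOn_jetMap (e.symm.trans e').open_source
    (contDiffOn_transition he he')).congr fun u hu => ?_
  simp only [mem_ofPred_eq, OpenPartialHomeomorph.trans_source, mem_inter_iff,
    OpenPartialHomeomorph.symm_source, mem_preimage] at hu
  exact coord_ofCoord' he he' u hu.1 hu.2

variable [IsManifold 𝓘(ℝ, E) ∞ M]

variable (E M k) in
/-- The atlas `{(πₖ⁻¹(U), Ψ)}` of `TᵏM`, one chart for each chart of the smooth structure of `M`. -/
def chartedSpaceCore : ChartedSpaceCore (Fin (k + 1) → E) (OscBundle E M k) where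
  atlas := {Φ | ∃ (e : OpenPartialHomeomorph M E)
    (he : e ∈ IsManifold.maximalAtlas 𝓘(ℝ, E) ∞ M), Φ = jetPartialEquiv k he}
  chartAt p := jetPartialEquiv k (IsManifold.chart_mem_maximalAtlas (proj p))
  mem_chart_source p := mem_chart_source E (proj p)
  chart_mem_atlas p := ⟨_, _, rfl⟩
  open_source := by
    rintro _ _ ⟨e, he, rfl⟩ ⟨e', he', rfl⟩
    rw [jetPartialEquiv_trans_source he he']
    exact (e.symm.trans e').open_source.preimage (continuous_apply 0)
  continuousOn_toFun := by
    rintro _ _ ⟨e, he, rfl⟩ ⟨e', he', rfl⟩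
    exact (contDiffOn_jetPartialEquiv_trans he he').continuousOn

instance : TopologicalSpace (OscBundle E M k) := (chartedSpaceCore E M k).toTopologicalSpace

instance : ChartedSpace (Fin (k + 1) → E) (OscBundle E M k) :=
  (chartedSpaceCore E M k).toChartedSpace

/-- The chart `Ψ` of `TᵏM` induced by a chart `ψ = e` of `M`. -/
def jetChart (k : ℕ) (he : e ∈ IsManifold.maximalAtlas 𝓘(ℝ, E) ∞ M) :
    OpenPartialHomeomorph (OscBundle E M k) (Fin (k + 1) → E) :=
  (chartedSpaceCore E M k).openPartialHomeomorph (jetPartialEquiv k he) ⟨e, he, rfl⟩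

@[simp] theorem jetChart_coe (he : e ∈ IsManifold.maximalAtlas 𝓘(ℝ, E) ∞ M) :
    (jetChart k he : OscBundle E M k → Fin (k + 1) → E) = coord e := rfl

@[simp] theorem jetChart_source (he : e ∈ IsManifold.maximalAtlas 𝓘(ℝ, E) ∞ M) :
    (jetChart k he).source = {p | proj p ∈ e.source} := rfl

theorem mem_atlas_iff (Φ : OpenPartialHomeomorph (OscBundle E M k) (Fin (k + 1) → E)) :
    Φ ∈ atlas (Fin (k + 1) → E) (OscBundle E M k) ↔
      ∃ (e : OpenPartialHomeomorph M E) (he : e ∈ IsManifold.maximalAtlas 𝓘(ℝ, E) ∞ M),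
        Φ = jetChart k he := by
  change Φ ∈ (⋃ (e : PartialEquiv (OscBundle E M k) (Fin (k + 1) → E))
    (he : e ∈ (chartedSpaceCore E M k).atlas),
      {(chartedSpaceCore E M k).openPartialHomeomorph e he}) ↔ _
  simp only [mem_iUnion, mem_singleton_iff]
  constructor
  · rintro ⟨_, ⟨e, he, rfl⟩, rfl⟩
    exact ⟨e, he, rfl⟩
  · rintro ⟨e, he, rfl⟩
    exact ⟨_, ⟨e, he, rfl⟩, rfl⟩

instance : IsManifold 𝓘(ℝ, Fin (k + 1) → E) ∞ (OscBundle E M k) := by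
  refine isManifold_of_contDiffOn _ _ _ fun Φ Φ' hΦ hΦ' => ?_
  obtain ⟨e, he, rfl⟩ := (mem_atlas_iff Φ).1 hΦ
  obtain ⟨e', he', rfl⟩ := (mem_atlas_iff Φ').1 hΦ'
  simp only [modelWithCornersSelf_coe, modelWithCornersSelf_coe_symm, range_id, inter_univ,
    preimage_id_eq, id_eq, Function.id_comp, Function.comp_id]
  exact contDiffOn_jetPartialEquiv_trans he he'

theorem jetChart_mem_maximalAtlas (he : e ∈ IsManifold.maximalAtlas 𝓘(ℝ, E) ∞ M) :
    jetChart k he ∈ IsManifold.maximalAtlas 𝓘(ℝ, Fin (k + 1) → E) ∞ (OscBundle E M k) :=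
  IsManifold.subset_maximalAtlas ((mem_atlas_iff _).2 ⟨e, he, rfl⟩)

/-- The endomorphism `J` of `T(TᵏM)`, given by `(y, η₁, …, ηₖ) ↦ (0, y, η₁, …, ηₖ₋₁)` in the
preferred chart at `p`, hence in every chart by `coord_almostTangent`. -/
def almostTangent (p : OscBundle E M k) :
    TangentSpace 𝓘(ℝ, Fin (k + 1) → E) p →L[ℝ] TangentSpace 𝓘(ℝ, Fin (k + 1) → E) p :=
  let D := mfderiv 𝓘(ℝ, Fin (k + 1) → E) 𝓘(ℝ, Fin (k + 1) → E) (coord (chartAt E (proj p))) p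
  D.inverse ∘L shift E k ∘L D

theorem mfderiv_coord_isInvertible (he : e ∈ IsManifold.maximalAtlas 𝓘(ℝ, E) ∞ M)
    (p : OscBundle E M k) (hp : proj p ∈ e.source) :
    (mfderiv 𝓘(ℝ, Fin (k + 1) → E) 𝓘(ℝ, Fin (k + 1) → E) (coord e) p).IsInvertible := by
  have h : (jetChart k he).MDifferentiable 𝓘(ℝ, Fin (k + 1) → E) 𝓘(ℝ, Fin (k + 1) → E) :=
    ⟨(contMDiffOn_of_mem_maximalAtlas (jetChart_mem_maximalAtlas he)).mdifferentiableOn (by simp),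
      (contMDiffOn_symm_of_mem_maximalAtlas (jetChart_mem_maximalAtlas he)).mdifferentiableOn
        (by simp)⟩
  exact ⟨h.mfderiv (x := p) hp, rfl⟩

theorem coord_almostTangent (he : e ∈ IsManifold.maximalAtlas 𝓘(ℝ, E) ∞ M)
    (p : OscBundle E M k) (hp : proj p ∈ e.source)
    (w : TangentSpace 𝓘(ℝ, Fin (k + 1) → E) p) :
    mfderiv 𝓘(ℝ, Fin (k + 1) → E) 𝓘(ℝ, Fin (k + 1) → E) (coord e) p (almostTangent p w) =
      shift E k (mfderiv 𝓘(ℝ, Fin (k + 1) → E) 𝓘(ℝ, Fin (k + 1) → E) (coord e) p w) := by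
  have hp₀ : proj p ∈ (chartAt E (proj p)).source := mem_chart_source E _
  have he₀ : chartAt E (proj p) ∈ IsManifold.maximalAtlas 𝓘(ℝ, E) ∞ M :=
    IsManifold.chart_mem_maximalAtlas _
  unfold almostTangent
  generalize chartAt E (proj p) = e₀ at hp₀ he₀
  obtain ⟨A, hA⟩ := mfderiv_coord_isInvertible he₀ p hp₀
  set S := (e₀.symm.trans e).source with hS
  have hSo : IsOpen S := (e₀.symm.trans e).open_source
  have hg := contDiffOn_transition he₀ he
  have hu : coord e₀ p 0 ∈ S := by
    rw [coord_zero he₀ p hp₀, hS]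
    simp [hp₀, hp]
  have hT : MDifferentiableAt 𝓘(ℝ, Fin (k + 1) → E) 𝓘(ℝ, Fin (k + 1) → E)
      (jetMap k (e ∘ e₀.symm)) (coord e₀ p) :=
    (((contDiffOn_jetMap hSo hg).contDiffAt
      ((hSo.preimage (continuous_apply 0)).mem_nhds hu)).differentiableAt
        (by simp)).mdifferentiableAt
  have hc : MDifferentiableAt 𝓘(ℝ, Fin (k + 1) → E) 𝓘(ℝ, Fin (k + 1) → E) (coord e₀) p :=
    (contMDiffAt_of_mem_maximalAtlas (jetChart_mem_maximalAtlas he₀) hp₀).mdifferentiableAt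
      (by simp)
  have hev : coord (k := k) e =ᶠ[𝓝 p] jetMap k (e ∘ e₀.symm) ∘ coord e₀ := by
    filter_upwards [(jetChart k he).open_source.mem_nhds hp,
      (jetChart k he₀).open_source.mem_nhds hp₀] with q hq hq₀
    have hq' : proj q ∈ e₀.source := hq₀
    have h1 : coord e₀ q 0 ∈ e₀.target := by
      rw [coord_zero he₀ q hq']; exact e₀.map_source hq'
    have h2 : e₀.symm (coord e₀ q 0) ∈ e.source := by
      rw [coord_zero he₀ q hq', e₀.left_inv hq']; exact hq
    rw [Function.comp_apply, ← coord_ofCoord' he₀ he _ h1 h2, ofCoord_coord he₀ q hq']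
  have hD : mfderiv 𝓘(ℝ, Fin (k + 1) → E) 𝓘(ℝ, Fin (k + 1) → E) (coord e) p =
      (fderiv ℝ (jetMap k (e ∘ e₀.symm)) (coord e₀ p)).comp
        (mfderiv 𝓘(ℝ, Fin (k + 1) → E) 𝓘(ℝ, Fin (k + 1) → E) (coord e₀) p) := by
    rw [hev.mfderiv_eq, mfderiv_comp p hT hc, mfderiv_eq_fderiv]
    rfl
  have hinv : ∀ x, mfderiv 𝓘(ℝ, Fin (k + 1) → E) 𝓘(ℝ, Fin (k + 1) → E) (coord e₀) p
      ((mfderiv 𝓘(ℝ, Fin (k + 1) → E) 𝓘(ℝ, Fin (k + 1) → E) (coord e₀) p).inverse x) = x := by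
    intro x
    rw [← hA, ContinuousLinearMap.inverse_equiv]
    exact A.apply_symm_apply x
  rw [hD]
  refine (congrArg (fderiv ℝ (jetMap k (e ∘ e₀.symm)) (coord e₀ p)) (hinv _)).trans ?_
  exact fderiv_jetMap_shift hSo hg _ hu _

end OscBundle

/-- The map `v ↦ (ψ(x), dψ(x) v)`, for `v ∈ TₓM`, induced by a chart `ψ = e` of `M`. -/
def tangentCoord (e : OpenPartialHomeomorph M E) (v : TangentBundle 𝓘(ℝ, E) M) : E × E :=
  (e v.1, mfderiv 𝓘(ℝ, E) 𝓘(ℝ, E) e v.1 v.2)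

variable [IsManifold 𝓘(ℝ, E) ∞ M]

/-- `Γ : ψ(U) × E → L(E, E)` is the local component in the chart `(U, ψ) = (e.source, e)` of the
map `D : TTM → TM`: it is smooth, linear in its second variable, and `D` reads
`(x, ξ; y, η) ↦ (x, η + Γ(x, ξ) y)` in the charts induced by `ψ`. The values of `Γ` outside
`ψ(U) × E` play no role. -/
structure IsLocalComponent
    (D : ∀ v : TangentBundle 𝓘(ℝ, E) M,
      TangentSpace 𝓘(ℝ, E).tangent v →L[ℝ] TangentSpace 𝓘(ℝ, E) v.1)
    (e : OpenPartialHomeomorph M E) (Γ : E → E → E →L[ℝ] E) : Prop where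
  contDiffOn : ContDiffOn ℝ ∞ (fun q : E × E => Γ q.1 q.2) (e.target ×ˢ univ)
  linear : ∀ x ∈ e.target, IsLinearMap ℝ (Γ x)
  local_form : ∀ v : TangentBundle 𝓘(ℝ, E) M, v.1 ∈ e.source →
    ∀ w : TangentSpace 𝓘(ℝ, E).tangent v,
      let q : E × E := tangentCoord e v
      let w' : E × E := mfderiv 𝓘(ℝ, E).tangent 𝓘(ℝ, E × E) (tangentCoord e) v w
      (mfderiv 𝓘(ℝ, E) 𝓘(ℝ, E) e v.1 (D v w) : E) = w'.2 + Γ q.1 q.2 w'.1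

variable (E M) in
/-- A linear connection on `M`: a vector bundle morphism `TTM → TM` over `TM → M` which in every
chart of the smooth structure has the form `(x, ξ; y, η) ↦ (x, η + Γ(x, ξ) y)` with
`Γ : ψ(U) × E → L(E, E)` smooth and linear in `ξ`. -/
structure LinearConnection where
  toFun : ∀ v : TangentBundle 𝓘(ℝ, E) M,
    TangentSpace 𝓘(ℝ, E).tangent v →L[ℝ] TangentSpace 𝓘(ℝ, E) v.1
  exists_localComponent : ∀ e ∈ IsManifold.maximalAtlas 𝓘(ℝ, E) ∞ M,
    ∃ Γ : E → E → E →L[ℝ] E, IsLocalComponent toFun e Γ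

variable (E M k) in
/-- A connection map on `TᵏM`: a smooth vector bundle morphism `K = (K¹, …, Kᵏ)` from `T(TᵏM)` to
the Whitney sum of `k` copies of `TM`, covering `πₖ`, with `Kᵏ ∘ Jᵃ = Kᵏ⁻ᵃ` for `1 ≤ a ≤ k - 1` and
`Kᵏ ∘ Jᵏ = d(πₖ)`, where `d(πₖ)` is the tangent map of `πₖ`. The component `Kⁱ⁺¹` has index `i : Fin k`.
The fibre of the Whitney sum over `x` is `Fin k → TₓM`. Smoothness is required both of the maps
between total spaces and, as is customary for Banach bundles, of the local representatives as maps
into the space of continuous linear operators. -/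
structure ConnectionMap where
  toFun : ∀ p : OscBundle E M k, TangentSpace 𝓘(ℝ, Fin (k + 1) → E) p →L[ℝ]
    (Fin k → TangentSpace 𝓘(ℝ, E) p.proj)
  contMDiff : ∀ i : Fin k,
    ContMDiff 𝓘(ℝ, Fin (k + 1) → E).tangent 𝓘(ℝ, E).tangent ∞
      (fun w : TangentBundle 𝓘(ℝ, Fin (k + 1) → E) (OscBundle E M k) =>
        (⟨w.1.proj, toFun w.1 w.2 i⟩ : TangentBundle 𝓘(ℝ, E) M))
  contMDiffAt_operator : ∀ (i : Fin k) (p₀ : OscBundle E M k),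
    ContMDiffAt 𝓘(ℝ, Fin (k + 1) → E) 𝓘(ℝ, (Fin (k + 1) → E) →L[ℝ] E) ∞
      (inTangentCoordinates 𝓘(ℝ, Fin (k + 1) → E) 𝓘(ℝ, E) (fun p : OscBundle E M k => p)
        OscBundle.proj (fun p => (ContinuousLinearMap.proj i).comp (toFun p)) p₀) p₀
  comp_almostTangent : ∀ (a : ℕ) (_ : 1 ≤ a) (_ : a < k) (p : OscBundle E M k)
    (w : TangentSpace 𝓘(ℝ, Fin (k + 1) → E) p),
    toFun p ((OscBundle.almostTangent p)^[a] w) ⟨k - 1, by omega⟩ =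
      toFun p w ⟨k - a - 1, by omega⟩
  comp_almostTangent_top : ∀ (_ : 1 ≤ k) (p : OscBundle E M k)
    (w : TangentSpace 𝓘(ℝ, Fin (k + 1) → E) p),
    toFun p ((OscBundle.almostTangent p)^[k] w) ⟨k - 1, by omega⟩ =
      mfderiv 𝓘(ℝ, Fin (k + 1) → E) 𝓘(ℝ, E) OscBundle.proj p w

/-- `K` has the local components `N₀ = M¹, N₁ = M², …` in the chart `(U, ψ) = (e.source, e)`, that
is, these are smooth on `ψ(U) × E × ⋯ × E`, and `Kⁱ` reads
`(u; y, η₁, …, ηₖ) ↦ ηᵢ + M¹(u) ηᵢ₋₁ + ⋯ + Mⁱ(u) y` in the charts induced by `ψ`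
(below, `Kⁱ` with `i` replaced by `i + 1` and `Mʲ` with `j` replaced by `j + 1`). -/
structure ConnectionMap.HasLocalComponents (K : ConnectionMap E M k)
    (e : OpenPartialHomeomorph M E) (N : (a : ℕ) → (Fin (a + 2) → E) → E →L[ℝ] E) : Prop where
  contDiffOn : ∀ a < k, ContDiffOn ℝ ∞ (N a) {u | u 0 ∈ e.target}
  local_form : ∀ p : OscBundle E M k, p.proj ∈ e.source →
    ∀ (w : TangentSpace 𝓘(ℝ, Fin (k + 1) → E) p) (i : Fin k),
      let u : Fin (k + 1) → E := OscBundle.coord e p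
      let η : Fin (k + 1) → E :=
        mfderiv 𝓘(ℝ, Fin (k + 1) → E) 𝓘(ℝ, Fin (k + 1) → E) (OscBundle.coord e) p w
      (mfderiv 𝓘(ℝ, E) 𝓘(ℝ, E) e p.proj (K.toFun p w i) : E) =
        η i.succ + ∑ j : Fin (i + 1),
          N j (fun l : Fin (j + 2) => u ⟨l, by omega⟩) (η ⟨i - j, by omega⟩)

end Manifold

/-- The local components `M¹, M², …` built from a local component `Γ` of a linear connection;
`liftedComponent Γ a` is `Mᵃ⁺¹`, a function of `(x, ξ₁, …, ξₐ₊₁) = (u 0, …, u (a + 1))`: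
`M¹(x, ξ₁) y = Γ(x, ξ₁) y` and, with `∂ᵢ` the partial derivative in the `i`-th variable,
`Mᵃ(x, ξ₁, …, ξₐ) y = (1/a) (∑ᵢ ∂ᵢ Mᵃ⁻¹(x, ξ₁, …, ξₐ₋₁) (y, i ξᵢ) + M¹(x, ξ₁) [Mᵃ⁻¹(x, …, ξₐ₋₁) y])`,
where the sum is over `1 ≤ i ≤ a`. -/
def liftedComponent {E : Type*} [NormedAddCommGroup E] [NormedSpace ℝ E]
    (Γ : E → E → E →L[ℝ] E) : (a : ℕ) → (Fin (a + 2) → E) → E →L[ℝ] E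
  | 0, u => Γ (u 0) (u 1)
  | a + 1, u => ((a : ℝ) + 2)⁻¹ •
      (∑ i : Fin (a + 2),
          fderiv ℝ (fun z => liftedComponent Γ a (Function.update (Fin.init u) i z))
            (Fin.init u i) (((i : ℝ) + 1) • u i.succ)
        + (Γ (u 0) (u 1)).comp (liftedComponent Γ a (Fin.init u)))

end HigherTangent

end

noncomputable section

namespace HigherTangent

/-! ### Taylor coefficients and covariant derivatives along curves -/

section CovariantJets

variable {E : Type*} [NormedAddCommGroup E] [NormedSpace ℝ E]

/-! The recursion for the components is the Leibniz rule for iterated covariant derivatives. Let `c`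
be a curve in a chart and `Y` a vector field along it, with Taylor coefficients `u` and `η` at time
`t`, and let `∇ₜ = d/dt + Γ(c, c')`. With `M⁰ = id`, the expression `Cᵢ = ηᵢ + M¹(u) ηᵢ₋₁ + ⋯ +
Mⁱ(u) η₀` equals `(1/i!) ∇ₜⁱ Y`. Indeed `C₀ = Y`, and the recursion for `Mᵃ` says precisely that `(i
+ 1) Cᵢ₊₁ = ∇ₜ Cᵢ` (`hasDerivAt_component`, `hasDerivAt_covJet`).

Covariant derivatives do not depend on the chart. The local components obey the usual transformation
law, obtained by comparing two chart expressions of the connection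
(`IsLocalComponent.fderiv_transition`). Induction on `i` then shows that a transition map `g` sends
`Cᵢ` for `(c, Y)` to `Cᵢ` for `(g ∘ c, Dg(c) Y)` (`covJet_comp`). Every tangent vector to the jet
space at `u` comes from a polynomial field along a polynomial curve, and the derivative of the jet
map acts on it by `Y ↦ Dg(c) Y` (`fderiv_jetMap_apply`). Hence the chart formulas for `Cᵢ` glue to a
global map `T(TᵏM) → TM` (`mfderiv_chart_covariantJet`).

In charts `J` shifts `η` by one place and puts `0` in front, so `Cᵢ₊₁ ∘ J = Cᵢ`. Both identities
required of a connection map are iterations of this, the last one because `C₀` is the tangent map of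
the projection. -/

theorem contDiffOn_iteratedDeriv {T : Set ℝ} (hT : IsOpen T) {c : ℝ → E}
    (hc : ContDiffOn ℝ ∞ c T) (n : ℕ) : ContDiffOn ℝ ∞ (iteratedDeriv n c) T := by
  induction n with
  | zero => simpa using hc
  | succ n ih =>
    rw [iteratedDeriv_succ]
    exact ih.deriv_of_isOpen hT (by simp)

/-- The `n`-th Taylor coefficient of a curve at the time `t`. -/
def taylorCoeff (c : ℝ → E) (t : ℝ) (n : ℕ) : E :=
  ((Nat.factorial n : ℕ) : ℝ)⁻¹ • iteratedDeriv n c t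

theorem taylorCoeff_zero (c : ℝ → E) (t : ℝ) : taylorCoeff c t 0 = c t := by simp [taylorCoeff]

/-- Moving the base time and dividing by `n!` produces the factor `n + 1`. This is the source of the
weights `i ξᵢ` in the recursion for the components: they form the velocity of the curve of jets. -/
theorem hasDerivAt_taylorCoeff {T : Set ℝ} (hT : IsOpen T) {c : ℝ → E}
    (hc : ContDiffOn ℝ ∞ c T) {t : ℝ} (ht : t ∈ T) (n : ℕ) :
    HasDerivAt (fun t => taylorCoeff c t n) (((n : ℝ) + 1) • taylorCoeff c t (n + 1)) t := by
  have hd : HasDerivAt (iteratedDeriv n c) (iteratedDeriv (n + 1) c t) t := by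
    rw [iteratedDeriv_succ]
    exact (((contDiffOn_iteratedDeriv hT hc n).contDiffAt (hT.mem_nhds ht)).differentiableAt
      (by simp)).hasDerivAt
  refine (hd.fun_const_smul (((Nat.factorial n : ℕ) : ℝ)⁻¹)).congr_deriv ?_
  rw [taylorCoeff, smul_smul, Nat.factorial_succ]
  congr 1
  push_cast
  field_simp

/-- Splitting `v` into its coordinate vectors expresses a total derivative by partial ones. It turns
the sum of partial derivatives in the recursion into a single derivative, to which the chain rule
applies. -/
theorem fderiv_apply_eq_sum_update {ι F : Type*} [Fintype ι] [DecidableEq ι]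
    [NormedAddCommGroup F] [NormedSpace ℝ F] {f : (ι → E) → F} {x : ι → E}
    (hf : DifferentiableAt ℝ f x) (v : ι → E) :
    fderiv ℝ f x v = ∑ i, fderiv ℝ (fun z => f (Function.update x i z)) (x i) (v i) := by
  have key : ∀ i, fderiv ℝ (fun z => f (Function.update x i z)) (x i) (v i) =
      fderiv ℝ f x (Pi.single i (v i)) := by
    intro i
    have h1 : HasFDerivAt f (fderiv ℝ f x) (Function.update x i (x i)) := by
      rw [Function.update_eq_self]; exact hf.hasFDerivAt
    have h2 := (h1.comp (x i) (hasFDerivAt_update (𝕜 := ℝ) x (x i))).fderiv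
    have e : (fun z => f (Function.update x i z)) = f ∘ Function.update x i := rfl
    rw [e, h2, ContinuousLinearMap.comp_apply]
    congr 1
    ext j
    by_cases h : j = i
    · subst h; simp
    · simp [h]
  simp_rw [key]
  rw [← map_sum, Finset.univ_sum_single]

/-! ### The components and their derivatives along a curve -/

section Components

variable {Γ : E → E → E →L[ℝ] E} {s : Set E}

/-- Index `i` here is variable number `i + 1` of the recursion, since `x` has index `0`; hence the
weight `i + 1` on `u i.succ`. -/
theorem liftedComponent_succ_of_differentiableAt {a : ℕ} {u : Fin (a + 3) → E}
    (h : DifferentiableAt ℝ (liftedComponent Γ a) (Fin.init u)) :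
    liftedComponent Γ (a + 1) u = ((a : ℝ) + 2)⁻¹ •
      (fderiv ℝ (liftedComponent Γ a) (Fin.init u) (fun i => ((i : ℝ) + 1) • u i.succ)
        + (Γ (u 0) (u 1)).comp (liftedComponent Γ a (Fin.init u))) := by
  rw [liftedComponent, fderiv_apply_eq_sum_update h]

/-- Smoothness of one component gives the differentiability that permits rewriting the next one with
a total derivative, so the two facts advance together in one induction. -/
theorem contDiffOn_liftedComponent (hs : IsOpen s)
    (hΓ : ContDiffOn ℝ ∞ (fun q : E × E => Γ q.1 q.2) (s ×ˢ univ)) (a : ℕ) :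
    ContDiffOn ℝ ∞ (liftedComponent Γ a) {u | u 0 ∈ s} := by
  have hopen : ∀ n : ℕ, IsOpen {u : Fin (n + 1) → E | u 0 ∈ s} := fun n =>
    hs.preimage (continuous_apply 0)
  have hΓ' : ∀ n : ℕ, ContDiffOn ℝ ∞ (fun u : Fin (n + 2) → E => Γ (u 0) (u 1)) {u | u 0 ∈ s} :=
    fun n => hΓ.comp (f := fun u : Fin (n + 2) → E => (u 0, u 1)) (by fun_prop)
      fun u hu => ⟨hu, mem_univ _⟩
  induction a with
  | zero => exact hΓ' 0
  | succ a ih =>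
    have hi : ContDiff ℝ ∞ (fun u : Fin (a + 3) → E => (Fin.init u : Fin (a + 2) → E)) := by
      unfold Fin.init; fun_prop
    have hm : MapsTo (fun u : Fin (a + 3) → E => (Fin.init u : Fin (a + 2) → E))
        {u | u 0 ∈ s} {u | u 0 ∈ s} := fun u hu => hu
    have h1 := ((ih.fderiv_of_isOpen (hopen _) (m := ∞) (by simp)).comp hi.contDiffOn hm).clm_apply
      (g := fun u : Fin (a + 3) → E => fun i : Fin (a + 2) => ((i : ℝ) + 1) • u i.succ)
      (by fun_prop)
    have h2 := (hΓ' (a + 1)).clm_comp (ih.comp hi.contDiffOn hm)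
    refine ((h1.add h2).const_smul (((a : ℝ) + 2)⁻¹)).congr fun u hu => ?_
    exact liftedComponent_succ_of_differentiableAt
      ((ih.contDiffAt ((hopen _).mem_nhds (hm hu))).differentiableAt (by simp))

/-- The components `M⁰ = id, M¹, M², …` as functions of a sequence `u = (x, ξ₁, ξ₂, …)`. -/
def component (Γ : E → E → E →L[ℝ] E) : ℕ → (ℕ → E) → E →L[ℝ] E
  | 0, _ => ContinuousLinearMap.id ℝ E
  | a + 1, u => liftedComponent Γ a fun l => u l

/-- By the chain rule the derivative of `Mᵃ` along the jets of `c` is the sum of partial derivatives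
in the recursion. Solving the recursion for that sum gives the formula. -/
theorem hasDerivAt_component (hs : IsOpen s)
    (hΓ : ContDiffOn ℝ ∞ (fun q : E × E => Γ q.1 q.2) (s ×ˢ univ))
    {T : Set ℝ} (hT : IsOpen T) {c : ℝ → E} (hc : ContDiffOn ℝ ∞ c T) (hcs : MapsTo c T s)
    {t : ℝ} (ht : t ∈ T) (a : ℕ) :
    HasDerivAt (fun t => component Γ a (taylorCoeff c t))
      (((a : ℝ) + 1) • component Γ (a + 1) (taylorCoeff c t) -
        (Γ (taylorCoeff c t 0) (taylorCoeff c t 1)).comp (component Γ a (taylorCoeff c t))) t := by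
  cases a with
  | zero =>
    -- `M⁰` is constant, and the right-hand side is `M¹ - Γ = 0`.
    refine (hasDerivAt_const t _).congr_deriv ?_
    simp [component, liftedComponent]
  | succ a =>
    have hx : (fun l : Fin (a + 2) => taylorCoeff c t l) ∈ {u : Fin (a + 2) → E | u 0 ∈ s} := by
      simpa [taylorCoeff_zero] using hcs ht
    have hd : DifferentiableAt ℝ (liftedComponent Γ a) (fun l : Fin (a + 2) => taylorCoeff c t l) :=
      ((contDiffOn_liftedComponent hs hΓ a).contDiffAt
        ((hs.preimage (continuous_apply 0)).mem_nhds hx)).differentiableAt (by simp)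
    have hj : HasDerivAt (fun t => fun l : Fin (a + 2) => taylorCoeff c t l)
        (fun l : Fin (a + 2) => ((l : ℝ) + 1) • taylorCoeff c t (l + 1)) t :=
      hasDerivAt_pi.2 fun l => by
        simpa using hasDerivAt_taylorCoeff hT hc ht (l : ℕ)
    refine (hd.hasFDerivAt.comp_hasDerivAt t hj).congr_deriv ?_
    have h := liftedComponent_succ_of_differentiableAt (Γ := Γ)
      (u := fun l : Fin (a + 3) => taylorCoeff c t l) hd
    have e : component Γ (a + 1 + 1) (taylorCoeff c t) =
      liftedComponent Γ (a + 1) (fun l : Fin (a + 3) => taylorCoeff c t l) := rfl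
    -- This factor cancels the normalisation `1/(a + 2)` of the recursion.
    have h2 : (((a + 1 : ℕ) : ℝ) + 1) = (a : ℝ) + 2 := by push_cast; ring
    rw [e, h, h2, smul_smul, mul_inv_cancel₀ (by positivity), one_smul]
    exact (add_sub_cancel_right _ _).symm

/-- The expression `ηᵢ + M¹(u) ηᵢ₋₁ + ⋯ + Mⁱ(u) η₀` for sequences `u` and `η`. -/
def covJet (Γ : E → E → E →L[ℝ] E) (i : ℕ) (u η : ℕ → E) : E :=
  ∑ p ∈ Finset.HasAntidiagonal.antidiagonal i, component Γ p.1 u (η p.2)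

theorem covJet_zero (u η : ℕ → E) : covJet Γ 0 u η = η 0 := by
  simp [covJet, component]

theorem component_congr {a : ℕ} {u v : ℕ → E} (h : ∀ n ≤ a, u n = v n) :
    component Γ a u = component Γ a v := by
  cases a with
  | zero => rfl
  | succ a =>
    simp only [component]
    congr 1
    funext l
    exact h l (by omega)

theorem covJet_congr {i : ℕ} {u v η ζ : ℕ → E} (hu : ∀ n ≤ i, u n = v n)
    (hη : ∀ n ≤ i, η n = ζ n) : covJet Γ i u η = covJet Γ i v ζ := by
  refine Finset.sum_congr rfl fun p hp => ?_
  rw [Finset.HasAntidiagonal.mem_antidiagonal] at hp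
  rw [component_congr (fun n hn => hu n (by omega)), hη _ (by omega)]

/-- The top component acts on `η 0 = 0` and drops out; the remaining terms are those of the previous
order. This is the algebra behind `Kⁱ⁺¹ ∘ J = Kⁱ`. -/
theorem covJet_succ_of_shift {i : ℕ} {u η ζ : ℕ → E} (h0 : η 0 = 0)
    (h : ∀ n ≤ i, η (n + 1) = ζ n) : covJet Γ (i + 1) u η = covJet Γ i u ζ := by
  unfold covJet
  rw [Finset.Nat.sum_antidiagonal_succ', h0, map_zero, zero_add]
  refine Finset.sum_congr rfl fun p hp => ?_
  rw [Finset.HasAntidiagonal.mem_antidiagonal] at hp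
  rw [h _ (by omega)]

/-- Read as `(i + 1) Cᵢ₊₁ = (d/dt + Γ(c, c')) Cᵢ`, this identifies `Cᵢ` with `1/i!` times the `i`-th
covariant derivative of `Y` along `c`. It is the product rule applied to each term of the sum. -/
theorem hasDerivAt_covJet (hs : IsOpen s)
    (hΓ : ContDiffOn ℝ ∞ (fun q : E × E => Γ q.1 q.2) (s ×ˢ univ))
    {T : Set ℝ} (hT : IsOpen T) {c Y : ℝ → E} (hc : ContDiffOn ℝ ∞ c T) (hcs : MapsTo c T s)
    (hY : ContDiffOn ℝ ∞ Y T) {t : ℝ} (ht : t ∈ T) (i : ℕ) :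
    HasDerivAt (fun t => covJet Γ i (taylorCoeff c t) (taylorCoeff Y t))
      (((i : ℝ) + 1) • covJet Γ (i + 1) (taylorCoeff c t) (taylorCoeff Y t) -
        Γ (taylorCoeff c t 0) (taylorCoeff c t 1)
          (covJet Γ i (taylorCoeff c t) (taylorCoeff Y t))) t := by
  have h := HasDerivAt.fun_sum (u := Finset.HasAntidiagonal.antidiagonal i) (x := t)
    fun p (_ : p ∈ Finset.HasAntidiagonal.antidiagonal i) =>
      (hasDerivAt_component hs hΓ hT hc hcs ht p.1).clm_apply (hasDerivAt_taylorCoeff hT hY ht p.2)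
  refine h.congr_deriv ?_
  generalize taylorCoeff c t = u
  generalize taylorCoeff Y t = η
  -- The factor `i + 1` is written as `p.1 + p.2` on the antidiagonal. In each half the term with
  -- weight zero disappears, and reindexing gives the two contributions of the product rule.
  have h1 : ((i : ℝ) + 1) • covJet Γ (i + 1) u η =
      ∑ p ∈ Finset.HasAntidiagonal.antidiagonal i, (((p.1 : ℝ) + 1) • component Γ (p.1 + 1) u (η p.2) +
        ((p.2 : ℝ) + 1) • component Γ p.1 u (η (p.2 + 1))) := by
    have e : ((i : ℝ) + 1) • covJet Γ (i + 1) u η =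
        ∑ p ∈ Finset.HasAntidiagonal.antidiagonal (i + 1), (p.1 : ℝ) • component Γ p.1 u (η p.2) +
        ∑ p ∈ Finset.HasAntidiagonal.antidiagonal (i + 1), (p.2 : ℝ) • component Γ p.1 u (η p.2) := by
      rw [covJet, Finset.smul_sum, ← Finset.sum_add_distrib]
      refine Finset.sum_congr rfl fun p hp => ?_
      rw [Finset.HasAntidiagonal.mem_antidiagonal] at hp
      rw [← add_smul]
      congr 1
      exact_mod_cast hp.symm
    rw [e, Finset.Nat.sum_antidiagonal_succ, Finset.Nat.sum_antidiagonal_succ',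
      Finset.sum_add_distrib]
    simp
  rw [h1, covJet, map_sum, ← Finset.sum_sub_distrib]
  refine Finset.sum_congr rfl fun p _ => ?_
  simp only [sub_apply, smul_apply,
    ContinuousLinearMap.comp_apply, map_smul]
  abel

end Components

/-- Naturality of the covariant jets under a map `g` that intertwines two connections. -/
theorem covJet_comp {Γ Γ' : E → E → E →L[ℝ] E} {s s' : Set E} (hs : IsOpen s) (hs' : IsOpen s')
    (hΓ : ContDiffOn ℝ ∞ (fun q : E × E => Γ q.1 q.2) (s ×ˢ univ))
    (hΓ' : ContDiffOn ℝ ∞ (fun q : E × E => Γ' q.1 q.2) (s' ×ˢ univ))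
    {g : E → E} (hg : ContDiffOn ℝ ∞ g s) (hgs : MapsTo g s s')
    (hgΓ : ∀ x ∈ s, ∀ ξ y : E, fderiv ℝ (fderiv ℝ g) x ξ y +
      Γ' (g x) (fderiv ℝ g x ξ) (fderiv ℝ g x y) = fderiv ℝ g x (Γ x ξ y))
    {T : Set ℝ} (hT : IsOpen T) {c Y : ℝ → E} (hc : ContDiffOn ℝ ∞ c T) (hcs : MapsTo c T s)
    (hY : ContDiffOn ℝ ∞ Y T) (i : ℕ) : ∀ t ∈ T,
    covJet Γ' i (taylorCoeff (g ∘ c) t) (taylorCoeff (fun t => fderiv ℝ g (c t) (Y t)) t) =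
      fderiv ℝ g (c t) (covJet Γ i (taylorCoeff c t) (taylorCoeff Y t)) := by
  have hDg : ContDiffOn ℝ ∞ (fderiv ℝ g) s := hg.fderiv_of_isOpen hs (by simp)
  have hgc : ContDiffOn ℝ ∞ (g ∘ c) T := hg.comp hc hcs
  have hgY : ContDiffOn ℝ ∞ (fun t => fderiv ℝ g (c t) (Y t)) T := (hDg.comp hc hcs).clm_apply hY
  induction i with
  -- Order zero is the plain vector field `Y`, which is pushed forward by `Dg`.
  | zero => intro t _; simp [covJet_zero, taylorCoeff_zero]
  | succ i ih =>
    intro t ht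
    have h1 := hasDerivAt_covJet hs' hΓ' hT hgc (hgs.comp hcs) hgY ht i
    have h2 := hasDerivAt_covJet hs hΓ hT hc hcs hY ht i
    have hc1 := hasDerivAt_taylorCoeff hT hc ht 0
    have hg1 := hasDerivAt_taylorCoeff hT hgc ht 0
    simp only [taylorCoeff_zero, Nat.cast_zero, zero_add, one_smul] at hc1 hg1
    have hD : HasFDerivAt (fderiv ℝ g) (fderiv ℝ (fderiv ℝ g) (c t)) (c t) :=
      ((hDg.contDiffAt (hs.mem_nhds (hcs ht))).differentiableAt (by simp)).hasFDerivAt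
    have h3 := (hD.comp_hasDerivAt t hc1).clm_apply h2
    have hgd : HasFDerivAt g (fderiv ℝ g (c t)) (c t) :=
      ((hg.contDiffAt (hs.mem_nhds (hcs ht))).differentiableAt (by simp)).hasFDerivAt
    have e1 : taylorCoeff (g ∘ c) t 1 = fderiv ℝ g (c t) (taylorCoeff c t 1) :=
      hg1.unique (hgd.comp_hasDerivAt t hc1)
    -- The induction hypothesis holds at all times near `t`, so it may be differentiated. This is
    -- why the claim is made on all of `T` and not only at one time.
    have h4 := h1.congr_of_eventuallyEq (f₁ := fun t => fderiv ℝ g (c t)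
      (covJet Γ i (taylorCoeff c t) (taylorCoeff Y t)))
      (Filter.eventuallyEq_of_mem (hT.mem_nhds ht) fun t ht => (ih t ht).symm)
    have h5 := h4.unique h3
    rw [ih t ht, e1, taylorCoeff_zero, taylorCoeff_zero] at h5
    simp only [Function.comp_apply, map_sub, map_smul] at h5
    -- The transformation law with `ξ = c'` and `y = Cᵢ` makes the second derivative of `g` cancel
    -- against the difference of the two connection terms.
    rw [← hgΓ _ (hcs ht), sub_eq_iff_eq_add] at h5
    have h6 : ((i : ℝ) + 1) ≠ 0 := by positivity
    refine smul_right_injective E h6 (h5.trans ?_)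
    dsimp only
    abel

end CovariantJets


/-! ### Covariant jets on the jet space of the model, and changes of charts -/

section JetMap

variable {E : Type*} [NormedAddCommGroup E] [NormedSpace ℝ E] {k : ℕ}

/-- The derivative of `jetMap k g` at `u` maps the Taylor coefficients of a vector field `Y` along
the curve `c` with Taylor coefficients `u` to those of the vector field `Dg(c) Y` along `g ∘ c`. -/
theorem fderiv_jetMap_apply {g : E → E} {s : Set E} (hs : IsOpen s) (hg : ContDiffOn ℝ ∞ g s)
    (u : Fin (k + 1) → E) (hu : u 0 ∈ s) (w : Fin (k + 1) → E) (j : Fin (k + 1)) :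
    fderiv ℝ (jetMap k g) u w j =
      taylorCoeff (fun t => fderiv ℝ g (polyCurve u t) (polyCurve w t)) 0 j := by
  set U : Set ((Fin (k + 1) → E) × ℝ) := {q | polyCurve q.1 q.2 ∈ s}
  have hU : IsOpen U := hs.preimage contDiff_polyCurve.continuous
  have hH : ContDiffOn ℝ ∞ (fun q : (Fin (k + 1) → E) × ℝ => g (polyCurve q.1 q.2)) U :=
    hg.comp contDiff_polyCurve.contDiffOn fun q hq => hq
  have hu0 : (u, (0 : ℝ)) ∈ U := by simpa [U, polyCurve_zero] using hu
  have hdiff : DifferentiableAt ℝ (jetMap k g) u :=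
    ((contDiffOn_jetMap hs hg).contDiffAt
      ((hs.preimage (continuous_apply 0)).mem_nhds hu)).differentiableAt (by simp)
  have hnear : ∀ᶠ t in 𝓝 (0 : ℝ), polyCurve u t ∈ s :=
    (contDiff_polyCurve_right u).continuous.continuousAt.eventually
      (hs.mem_nhds (by simpa [polyCurve_zero] using hu))
  have hj : DifferentiableAt ℝ (fun u => iteratedDeriv j (g ∘ polyCurve u) 0) u := by
    have := (contDiffOn_partial hU _ hH j).comp (f := fun u => (u, (0 : ℝ)))
      (s := {u | u 0 ∈ s}) (by fun_prop)
      (fun u hu => by simpa [U, polyCurve_zero] using hu)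
    exact (this.contDiffAt ((hs.preimage (continuous_apply 0)).mem_nhds hu)).differentiableAt
      (by simp)
  have h1 : fderiv ℝ (jetMap k g) u w j = fderiv ℝ (fun u => jetMap k g u j) u w := by
    rw [fderiv_apply hdiff j]; rfl
  have h2 : (fun u => jetMap k g u j) =
      fun u => ((Nat.factorial j : ℕ) : ℝ)⁻¹ • iteratedDeriv j (g ∘ polyCurve u) 0 := rfl
  rw [taylorCoeff, h1, h2, fderiv_fun_const_smul hj]
  simp only [smul_apply]
  congr 1
  -- The derivative in the jet direction `w` is interchanged with the `j`-th time derivative.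
  have h3 := fderiv_partial hU j _ hH (u, 0) hu0 w
  refine h3.trans ?_
  refine Filter.EventuallyEq.iteratedDeriv_eq _ ?_
  filter_upwards [hnear] with t ht
  have hgd := ((hg.contDiffAt (hs.mem_nhds ht)).differentiableAt (by simp)).hasFDerivAt
  have hp : HasFDerivAt (fun q : (Fin (k + 1) → E) × ℝ => polyCurve q.1 q.2)
      (fderiv ℝ (fun q : (Fin (k + 1) → E) × ℝ => polyCurve q.1 q.2) (u, t)) (u, t) :=
    ((contDiff_polyCurve.contDiffAt).differentiableAt (by simp)).hasFDerivAt
  have h4 := (HasFDerivAt.comp (f := fun q : (Fin (k + 1) → E) × ℝ => polyCurve q.1 q.2)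
    (u, t) hgd hp).fderiv
  have h5 : fderiv ℝ (fun q : (Fin (k + 1) → E) × ℝ => polyCurve q.1 q.2) (u, t) (w, 0) =
      polyCurve w t := by
    have hL : HasFDerivAt (fun r : ℝ => ((u, t) : (Fin (k + 1) → E) × ℝ) + r • (w, (0 : ℝ)))
        ((ContinuousLinearMap.id ℝ ℝ).smulRight (w, (0 : ℝ))) 0 := by
      simpa using ((hasFDerivAt_id (𝕜 := ℝ) (0 : ℝ)).smul_const (w, (0 : ℝ))).const_add
        ((u, t) : (Fin (k + 1) → E) × ℝ)
    have hp' : DifferentiableAt ℝ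
        (fun q : (Fin (k + 1) → E) × ℝ => polyCurve q.1 q.2) (u, t) := hp.differentiableAt
    -- `polyCurve` is linear in its coefficients, so its derivative in the direction `(w, 0)` is
    -- read off along a line.
    rw [← hp'.lineDeriv_eq_fderiv]
    have : (fun r : ℝ => polyCurve (((u, t) : (Fin (k + 1) → E) × ℝ) + r • (w, (0 : ℝ))).1
        (((u, t) : (Fin (k + 1) → E) × ℝ) + r • (w, (0 : ℝ))).2) =
        fun r => polyCurve u t + r • polyCurve w t := by
      funext r
      simp only [polyCurve, Prod.fst_add, Prod.snd_add, Prod.smul_fst, Prod.smul_snd, smul_zero,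
        add_zero, Pi.add_apply, Pi.smul_apply, smul_add, Finset.sum_add_distrib,
        Finset.smul_sum]
      congr 1
      exact Finset.sum_congr rfl fun i _ => smul_comm _ _ _
    rw [lineDeriv, this]
    simpa using (((hasDerivAt_id (0 : ℝ)).smul_const (polyCurve w t)).const_add
      (polyCurve u t)).deriv
  have h6 := congrArg (fun A => A (w, (0 : ℝ))) h4
  simp only [ContinuousLinearMap.comp_apply] at h6
  rw [h5] at h6
  exact h6

/-- The `n`-th coordinate of a jet, which is zero for `n > k`. -/
def jetProj (E : Type*) [NormedAddCommGroup E] [NormedSpace ℝ E] (k n : ℕ) :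
    (Fin (k + 1) → E) →L[ℝ] E :=
  if h : n < k + 1 then ContinuousLinearMap.proj ⟨n, h⟩ else 0

theorem jetProj_apply {n : ℕ} (h : n < k + 1) (u : Fin (k + 1) → E) :
    jetProj E k n u = u ⟨n, h⟩ := by
  simp [jetProj, h]

theorem jetProj_eq_taylorCoeff_polyCurve (u : Fin (k + 1) → E) {n : ℕ} (h : n < k + 1) :
    jetProj E k n u = taylorCoeff (polyCurve u) 0 n := by
  rw [jetProj_apply h]
  exact (congrFun (taylorJet_polyCurve u) ⟨n, h⟩).symm

/-- `η ↦ ηᵢ + M¹(u) ηᵢ₋₁ + ⋯ + Mⁱ(u) η₀` as a continuous linear map. -/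
def covJetCLM (Γ : E → E → E →L[ℝ] E) (i : ℕ) (u : Fin (k + 1) → E) : (Fin (k + 1) → E) →L[ℝ] E :=
  ∑ p ∈ Finset.HasAntidiagonal.antidiagonal i,
    (component Γ p.1 fun n => jetProj E k n u).comp (jetProj E k p.2)

variable {Γ Γ' : E → E → E →L[ℝ] E} {s s' : Set E}

theorem covJetCLM_apply (i : ℕ) (u η : Fin (k + 1) → E) :
    covJetCLM Γ i u η = covJet Γ i (fun n => jetProj E k n u) (fun n => jetProj E k n η) := by
  simp [covJetCLM, covJet]

theorem covJetCLM_zero (u η : Fin (k + 1) → E) : covJetCLM Γ 0 u η = η 0 := by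
  rw [covJetCLM_apply, covJet_zero, jetProj_apply (by omega)]; rfl

theorem covJetCLM_shift {i : ℕ} (hi : i < k) (u η : Fin (k + 1) → E) :
    covJetCLM Γ (i + 1) u (shift E k η) = covJetCLM Γ i u η := by
  rw [covJetCLM_apply, covJetCLM_apply]
  refine covJet_succ_of_shift ?_ fun n hn => ?_
  · rw [jetProj_apply (by omega)]
    exact shift_zero η
  · rw [jetProj_apply (by omega), jetProj_apply (by omega)]
    exact shift_succ η ⟨n, by omega⟩

/-- The bound `i + a ≤ k` keeps every index inside the jet, where `jetProj` is a genuine coordinate.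
-/
theorem covJetCLM_shift_iterate {i a : ℕ} (h : i + a ≤ k) (u η : Fin (k + 1) → E) :
    covJetCLM Γ (i + a) u ((shift E k)^[a] η) = covJetCLM Γ i u η := by
  induction a with
  | zero => rfl
  | succ a ih =>
    rw [Function.iterate_succ_apply', ← add_assoc, covJetCLM_shift (by omega), ih (by omega)]

theorem covJetCLM_succ_apply {i : ℕ} (hi : i < k) (u η : Fin (k + 1) → E) :
    covJetCLM Γ (i + 1) u η = η ⟨i + 1, by omega⟩ + ∑ j : Fin (i + 1),
      liftedComponent Γ j (fun l : Fin (j + 2) => u ⟨l, by omega⟩) (η ⟨i - j, by omega⟩) := by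
  -- The term of `M⁰ = id` is split off as the leading coordinate; the others are shifted by one
  -- because `liftedComponent Γ j` is `Mʲ⁺¹`.
  rw [covJetCLM_apply, covJet, Finset.Nat.sum_antidiagonal_eq_sum_range_succ_mk,
    Finset.sum_range_succ', add_comm, ← Fin.sum_univ_eq_sum_range]
  congr 1
  · exact jetProj_apply (by omega) η
  · refine Finset.sum_congr rfl fun j _ => ?_
    simp only [component]
    congr 2
    · funext l
      exact jetProj_apply (by omega) u
    · rw [jetProj_apply (by omega)]
      congr 2
      omega

theorem contDiffOn_covJetCLM (hs : IsOpen s)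
    (hΓ : ContDiffOn ℝ ∞ (fun q : E × E => Γ q.1 q.2) (s ×ˢ univ)) (i : ℕ) :
    ContDiffOn ℝ ∞ (fun u : Fin (k + 1) → E => covJetCLM Γ i u) {u | u 0 ∈ s} := by
  refine ContDiffOn.sum fun p _ => ContDiffOn.clm_comp ?_ contDiffOn_const
  generalize p.1 = a
  cases a with
  | zero => exact contDiffOn_const
  | succ a =>
    refine (contDiffOn_liftedComponent hs hΓ a).comp
      (f := fun u : Fin (k + 1) → E => fun l : Fin (a + 2) => jetProj E k l u) ?_ ?_
    · exact contDiffOn_pi.2 fun l => (jetProj E k l).contDiff.contDiffOn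
    · intro u hu
      have : jetProj E k 0 u = u 0 := jetProj_apply (by omega) u
      simpa [this] using hu

/-- Naturality of covariant derivatives, evaluated at time `0` on the polynomial curve and field
with coefficients `u` and `η`. It makes the chart formulas compatible. -/
theorem covJetCLM_jetMap (hs : IsOpen s) (hs' : IsOpen s')
    (hΓ : ContDiffOn ℝ ∞ (fun q : E × E => Γ q.1 q.2) (s ×ˢ univ))
    (hΓ' : ContDiffOn ℝ ∞ (fun q : E × E => Γ' q.1 q.2) (s' ×ˢ univ))
    {g : E → E} (hg : ContDiffOn ℝ ∞ g s) (hgs : MapsTo g s s')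
    (hgΓ : ∀ x ∈ s, ∀ ξ y : E, fderiv ℝ (fderiv ℝ g) x ξ y +
      Γ' (g x) (fderiv ℝ g x ξ) (fderiv ℝ g x y) = fderiv ℝ g x (Γ x ξ y))
    {u : Fin (k + 1) → E} (hu : u 0 ∈ s) (η : Fin (k + 1) → E) {i : ℕ} (hi : i ≤ k) :
    covJetCLM Γ' i (jetMap k g u) (fderiv ℝ (jetMap k g) u η) =
      fderiv ℝ g (u 0) (covJetCLM Γ i u η) := by
  have hc := contDiff_polyCurve_right u
  have h := covJet_comp hs hs' hΓ hΓ' hg hgs hgΓ (hs.preimage hc.continuous)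
    (hc.contDiffOn (s := polyCurve u ⁻¹' s)) (fun t ht => ht)
    (contDiff_polyCurve_right η).contDiffOn i 0 (by simpa [polyCurve_zero] using hu)
  rw [polyCurve_zero] at h
  rw [covJetCLM_apply, covJetCLM_apply]
  -- Only coefficients of order at most `i ≤ k` enter, so the zero values of `jetProj` beyond order
  -- `k` do no harm.
  refine Eq.trans (covJet_congr ?_ ?_) (h.trans (congrArg _ (covJet_congr ?_ ?_)))
  · intro n hn
    rw [jetProj_apply (by omega)]
    rfl
  · intro n hn
    rw [jetProj_apply (by omega), fderiv_jetMap_apply hs hg u hu]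
  · intro n hn
    rw [jetProj_eq_taylorCoeff_polyCurve u (by omega)]
  · intro n hn
    rw [jetProj_eq_taylorCoeff_polyCurve η (by omega)]

end JetMap


/-! ### Transition maps and the transformation law of a connection -/

section Transition

variable {E : Type*} [NormedAddCommGroup E] [NormedSpace ℝ E]
  {M : Type*} [TopologicalSpace M] [ChartedSpace E M] {k : ℕ}
  {e e' : OpenPartialHomeomorph M E}

theorem mdifferentiable_of_mem_maximalAtlas (he : e ∈ IsManifold.maximalAtlas 𝓘(ℝ, E) ∞ M) :
    e.MDifferentiable 𝓘(ℝ, E) 𝓘(ℝ, E) :=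
  ⟨(contMDiffOn_of_mem_maximalAtlas he).mdifferentiableOn (by simp),
    (contMDiffOn_symm_of_mem_maximalAtlas he).mdifferentiableOn (by simp)⟩

theorem mfderiv_chart_injective (he : e ∈ IsManifold.maximalAtlas 𝓘(ℝ, E) ∞ M) {m : M}
    (hm : m ∈ e.source) : Function.Injective (mfderiv 𝓘(ℝ, E) 𝓘(ℝ, E) e m) :=
  ((mdifferentiable_of_mem_maximalAtlas he).mfderiv hm).injective

theorem mfderiv_chart_eq_fderiv_transition (he : e ∈ IsManifold.maximalAtlas 𝓘(ℝ, E) ∞ M)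
    (he' : e' ∈ IsManifold.maximalAtlas 𝓘(ℝ, E) ∞ M) {m : M} (hm : m ∈ e.source)
    (hm' : m ∈ e'.source) :
    (mfderiv 𝓘(ℝ, E) 𝓘(ℝ, E) e' m : E →L[ℝ] E) =
      (fderiv ℝ (e' ∘ e.symm) (e m)).comp (mfderiv 𝓘(ℝ, E) 𝓘(ℝ, E) e m : E →L[ℝ] E) := by
  have hS : e m ∈ (e.symm.trans e').source := by simp [hm, hm']
  have hg : MDifferentiableAt 𝓘(ℝ, E) 𝓘(ℝ, E) (e' ∘ e.symm) (e m) :=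
    (((OscBundle.contDiffOn_transition he he').contDiffAt
      ((e.symm.trans e').open_source.mem_nhds hS)).differentiableAt (by simp)).mdifferentiableAt
  have hev : e' =ᶠ[𝓝 m] (e' ∘ e.symm) ∘ e := by
    filter_upwards [e.open_source.mem_nhds hm] with q hq
    simp [e.left_inv hq]
  rw [hev.mfderiv_eq,
    mfderiv_comp m hg ((mdifferentiable_of_mem_maximalAtlas he).mdifferentiableAt hm),
    mfderiv_eq_fderiv]
  rfl

theorem coord_zero_mem_transition_source (he : e ∈ IsManifold.maximalAtlas 𝓘(ℝ, E) ∞ M)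
    (p : OscBundle E M k) (hp : p.proj ∈ e.source) (hp' : p.proj ∈ e'.source) :
    OscBundle.coord e p 0 ∈ (e.symm.trans e').source := by
  rw [OscBundle.coord_zero he p hp]
  simp [hp, hp']

/-- The inverse of `tangentCoord e`. -/
def tangentCoordSymm (e : OpenPartialHomeomorph M E) (q : E × E) : TangentBundle 𝓘(ℝ, E) M :=
  ⟨e.symm q.1, mfderiv 𝓘(ℝ, E) 𝓘(ℝ, E) e.symm q.1 q.2⟩

theorem tangentCoord_tangentCoordSymm (he : e ∈ IsManifold.maximalAtlas 𝓘(ℝ, E) ∞ M)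
    (he' : e' ∈ IsManifold.maximalAtlas 𝓘(ℝ, E) ∞ M) {q : E × E}
    (hq : q.1 ∈ (e.symm.trans e').source) :
    tangentCoord e' (tangentCoordSymm e q) =
      ((e' ∘ e.symm) q.1, fderiv ℝ (e' ∘ e.symm) q.1 q.2) := by
  have hq' : q.1 ∈ e.target ∧ e.symm q.1 ∈ e'.source := by simpa using hq
  refine Prod.ext rfl ?_
  rw [← mfderiv_eq_fderiv, mfderiv_comp q.1
    ((mdifferentiable_of_mem_maximalAtlas he').mdifferentiableAt hq'.2)
    ((mdifferentiable_of_mem_maximalAtlas he).mdifferentiableAt_symm hq'.1)]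
  rfl

variable [IsManifold 𝓘(ℝ, E) ∞ M]

theorem coord_eventuallyEq (he : e ∈ IsManifold.maximalAtlas 𝓘(ℝ, E) ∞ M)
    (he' : e' ∈ IsManifold.maximalAtlas 𝓘(ℝ, E) ∞ M) (p : OscBundle E M k)
    (hp : p.proj ∈ e.source) (hp' : p.proj ∈ e'.source) :
    OscBundle.coord (k := k) e' =ᶠ[𝓝 p] jetMap k (e' ∘ e.symm) ∘ OscBundle.coord e := by
  filter_upwards [(OscBundle.jetChart k he').open_source.mem_nhds hp',
    (OscBundle.jetChart k he).open_source.mem_nhds hp] with q hq' hq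
  have hq₀ : q.proj ∈ e.source := hq
  have h1 : OscBundle.coord e q 0 ∈ e.target := by
    rw [OscBundle.coord_zero he q hq₀]; exact e.map_source hq₀
  have h2 : e.symm (OscBundle.coord e q 0) ∈ e'.source := by
    rw [OscBundle.coord_zero he q hq₀, e.left_inv hq₀]; exact hq'
  rw [Function.comp_apply, ← OscBundle.coord_ofCoord' he he' _ h1 h2,
    OscBundle.ofCoord_coord he q hq₀]

theorem mdifferentiableAt_coord (he : e ∈ IsManifold.maximalAtlas 𝓘(ℝ, E) ∞ M)
    (p : OscBundle E M k) (hp : p.proj ∈ e.source) :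
    MDifferentiableAt 𝓘(ℝ, Fin (k + 1) → E) 𝓘(ℝ, Fin (k + 1) → E) (OscBundle.coord e) p :=
  (contMDiffAt_of_mem_maximalAtlas (OscBundle.jetChart_mem_maximalAtlas he)
    hp).mdifferentiableAt (by simp)

theorem mfderiv_coord_eq_fderiv_jetMap (he : e ∈ IsManifold.maximalAtlas 𝓘(ℝ, E) ∞ M)
    (he' : e' ∈ IsManifold.maximalAtlas 𝓘(ℝ, E) ∞ M) (p : OscBundle E M k)
    (hp : p.proj ∈ e.source) (hp' : p.proj ∈ e'.source) :
    mfderiv 𝓘(ℝ, Fin (k + 1) → E) 𝓘(ℝ, Fin (k + 1) → E) (OscBundle.coord e') p =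
      (fderiv ℝ (jetMap k (e' ∘ e.symm)) (OscBundle.coord e p)).comp
        (mfderiv 𝓘(ℝ, Fin (k + 1) → E) 𝓘(ℝ, Fin (k + 1) → E) (OscBundle.coord e) p) := by
  have hT : MDifferentiableAt 𝓘(ℝ, Fin (k + 1) → E) 𝓘(ℝ, Fin (k + 1) → E)
      (jetMap k (e' ∘ e.symm)) (OscBundle.coord e p) :=
    (((contDiffOn_jetMap (e.symm.trans e').open_source (OscBundle.contDiffOn_transition he he')).contDiffAt
      (((e.symm.trans e').open_source.preimage (continuous_apply 0)).mem_nhds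
        (coord_zero_mem_transition_source he p hp hp'))).differentiableAt
          (by simp)).mdifferentiableAt
  rw [(coord_eventuallyEq he he' p hp hp').mfderiv_eq,
    mfderiv_comp p hT (mdifferentiableAt_coord he p hp), mfderiv_eq_fderiv]
  rfl

theorem contMDiffOn_tangentCoord (he : e ∈ IsManifold.maximalAtlas 𝓘(ℝ, E) ∞ M) :
    ContMDiffOn 𝓘(ℝ, E).tangent 𝓘(ℝ, E × E) ∞ (tangentCoord e)
      {v : TangentBundle 𝓘(ℝ, E) M | v.1 ∈ e.source} := by
  have h1 := (contMDiffOn_of_mem_maximalAtlas he).contMDiffOn_tangentMapWithin (m := ∞) (by simp)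
    e.open_source.uniqueMDiffOn
  refine ContMDiffOn.prodMk_space (f := fun v : TangentBundle 𝓘(ℝ, E) M => e v.1)
    (g := fun v => mfderiv 𝓘(ℝ, E) 𝓘(ℝ, E) e v.1 v.2)
    ((contMDiffOn_of_mem_maximalAtlas he).comp
      (Bundle.contMDiff_proj (TangentSpace 𝓘(ℝ, E))).contMDiffOn fun v hv => hv) ?_
  refine ((contMDiff_snd_tangentBundle_modelSpace E 𝓘(ℝ, E)).comp_contMDiffOn h1).congr
    fun v hv => ?_
  exact congrArg (fun p : TangentBundle 𝓘(ℝ, E) E => (p.2 : E))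
    (tangentMapWithin_eq_tangentMap (e.open_source.uniqueMDiffOn _ hv)
      ((mdifferentiable_of_mem_maximalAtlas he).mdifferentiableAt hv)).symm

theorem contMDiffOn_tangentCoordSymm (he : e ∈ IsManifold.maximalAtlas 𝓘(ℝ, E) ∞ M) :
    ContMDiffOn 𝓘(ℝ, E × E) 𝓘(ℝ, E).tangent ∞ (tangentCoordSymm e) (e.target ×ˢ univ) := by
  have h1 := (contMDiffOn_symm_of_mem_maximalAtlas he).contMDiffOn_tangentMapWithin (m := ∞)
    (by simp) e.open_target.uniqueMDiffOn
  -- The tangent bundle of the model space is the product `E × E`.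
  have h0 : ContMDiff 𝓘(ℝ, E × E) 𝓘(ℝ, E).tangent ∞
      (fun q : E × E => (⟨q.1, q.2⟩ : TangentBundle 𝓘(ℝ, E) E)) := by
    intro q
    refine Bundle.contMDiffAt_totalSpace.2 ⟨contDiff_fst.contMDiff.contMDiffAt, ?_⟩
    convert! (contDiff_snd (𝕜 := ℝ) (E := E) (F := E) (n := ∞)).contMDiff.contMDiffAt (x := q)
      using 1
    funext q
    simp
  refine (h1.comp h0.contMDiffOn (s := e.target ×ˢ univ) (fun q hq => hq.1)).congr fun q hq => ?_
  exact (tangentMapWithin_eq_tangentMap (p := (⟨q.1, q.2⟩ : TangentBundle 𝓘(ℝ, E) E))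
    (e.open_target.uniqueMDiffOn _ hq.1)
    ((mdifferentiable_of_mem_maximalAtlas he).mdifferentiableAt_symm hq.1)).symm

/-- The change of charts on `TM` is `(x, ξ) ↦ (g x, Dg(x) ξ)`. Differentiating in the direction `(y,
0)` leaves only the second-derivative term in the fibre, which is what the transformation law needs.
-/
theorem mfderiv_tangentCoord_tangentCoordSymm (he : e ∈ IsManifold.maximalAtlas 𝓘(ℝ, E) ∞ M)
    (he' : e' ∈ IsManifold.maximalAtlas 𝓘(ℝ, E) ∞ M) {x : E}
    (hx : x ∈ (e.symm.trans e').source) (ξ y : E) :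
    (mfderiv 𝓘(ℝ, E).tangent 𝓘(ℝ, E × E) (tangentCoord e') (tangentCoordSymm e (x, ξ))
      (mfderiv 𝓘(ℝ, E × E) 𝓘(ℝ, E).tangent (tangentCoordSymm e) (x, ξ) (y, 0)) : E × E) =
    (fderiv ℝ (e' ∘ e.symm) x y, fderiv ℝ (fderiv ℝ (e' ∘ e.symm)) x y ξ) := by
  have hx' : x ∈ e.target ∧ e.symm x ∈ e'.source := by simpa using hx
  set g := e' ∘ e.symm with hgdef
  have hso := (e.symm.trans e').open_source
  have hg : ContDiffAt ℝ ∞ g x := (OscBundle.contDiffOn_transition he he').contDiffAt (hso.mem_nhds hx)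
  have h1 : MDifferentiableAt 𝓘(ℝ, E).tangent 𝓘(ℝ, E × E) (tangentCoord e')
      (tangentCoordSymm e (x, ξ)) :=
    ((contMDiffOn_tangentCoord he').contMDiffAt ((e'.open_source.preimage
      (FiberBundle.continuous_proj E (TangentSpace 𝓘(ℝ, E)))).mem_nhds hx'.2)).mdifferentiableAt
        (by simp)
  have h2 : MDifferentiableAt 𝓘(ℝ, E × E) 𝓘(ℝ, E).tangent (tangentCoordSymm e) (x, ξ) :=
    ((contMDiffOn_tangentCoordSymm he).contMDiffAt
      ((e.open_target.prod isOpen_univ).mem_nhds ⟨hx'.1, mem_univ _⟩)).mdifferentiableAt (by simp)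
  have hev : tangentCoord e' ∘ tangentCoordSymm e =ᶠ[𝓝 (x, ξ)]
      fun q : E × E => (g q.1, fderiv ℝ g q.1 q.2) := by
    filter_upwards [(hso.prod isOpen_univ).mem_nhds (⟨hx, mem_univ _⟩ : (x, ξ) ∈ _ ×ˢ univ)]
      with q hq
    exact tangentCoord_tangentCoordSymm he he' hq.1
  have h3 := mfderiv_comp (x, ξ) h1 h2
  rw [hev.mfderiv_eq, mfderiv_eq_fderiv] at h3
  have hD : HasFDerivAt (fderiv ℝ g) (fderiv ℝ (fderiv ℝ g) x) x :=
    ((hg.fderiv_right (m := 1) (by decide)).differentiableAt (by simp)).hasFDerivAt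
  have hf : HasFDerivAt (fun q : E × E => q.1) (ContinuousLinearMap.fst ℝ E E) (x, ξ) :=
    hasFDerivAt_fst
  have h4 := (HasFDerivAt.comp (x, ξ) (hg.differentiableAt (by simp)).hasFDerivAt hf).prodMk
    ((HasFDerivAt.comp (x, ξ) hD hf).clm_apply
      (hasFDerivAt_snd (𝕜 := ℝ) (E := E) (F := E) (p := (x, ξ))))
  have h5 := congrArg (fun A : E × E →L[ℝ] E × E => A (y, 0)) (h3.symm.trans h4.fderiv)
  refine Eq.trans h5 ?_
  simp
  rfl

/-- The transformation law of the local components of a connection. -/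
theorem IsLocalComponent.fderiv_transition
    {D : ∀ v : TangentBundle 𝓘(ℝ, E) M,
      TangentSpace 𝓘(ℝ, E).tangent v →L[ℝ] TangentSpace 𝓘(ℝ, E) v.1}
    {Γ Γ' : E → E → E →L[ℝ] E}
    (he : e ∈ IsManifold.maximalAtlas 𝓘(ℝ, E) ∞ M) (he' : e' ∈ IsManifold.maximalAtlas 𝓘(ℝ, E) ∞ M)
    (h : IsLocalComponent D e Γ) (h' : IsLocalComponent D e' Γ')
    {x : E} (hx : x ∈ (e.symm.trans e').source) (ξ y : E) :
    fderiv ℝ (fderiv ℝ (e' ∘ e.symm)) x ξ y +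
      Γ' ((e' ∘ e.symm) x) (fderiv ℝ (e' ∘ e.symm) x ξ) (fderiv ℝ (e' ∘ e.symm) x y) =
      fderiv ℝ (e' ∘ e.symm) x (Γ x ξ y) := by
  have hx' : x ∈ e.target ∧ e.symm x ∈ e'.source := by simpa using hx
  have hx₀ : x ∈ (e.symm.trans e).source := by simp [hx'.1]
  have hsym : IsSymmSndFDerivAt ℝ (e' ∘ e.symm) x :=
    ((OscBundle.contDiffOn_transition he he').contDiffAt
      ((e.symm.trans e').open_source.mem_nhds hx)).isSymmSndFDerivAt (by simp; decide)
  have hid : e ∘ e.symm =ᶠ[𝓝 x] id := by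
    filter_upwards [e.open_target.mem_nhds hx'.1] with z hz
    exact e.right_inv hz
  -- The test vector whose expression in `e` is `(x, ξ; y, 0)`: the connection takes it to `Γ(x, ξ)
  -- y` in `e` (`f1`), while `f2` evaluates it in `e'`.
  set w := mfderiv 𝓘(ℝ, E × E) 𝓘(ℝ, E).tangent (tangentCoordSymm e) (x, ξ) (y, 0)
  have hid2 : fderiv ℝ (fderiv ℝ (id : E → E)) x = 0 := by
    have : fderiv ℝ (id : E → E) = fun _ => ContinuousLinearMap.id ℝ E := by
      funext z; exact fderiv_id
    rw [this]; exact fderiv_const_apply _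
  have f1 := (h.local_form (tangentCoordSymm e (x, ξ)) (e.map_target hx'.1) w).trans
    (congrArg₂ (fun A t : E × E => A.2 + Γ t.1 t.2 A.1)
      (mfderiv_tangentCoord_tangentCoordSymm he he hx₀ ξ y)
      (tangentCoord_tangentCoordSymm he he (q := (x, ξ)) hx₀))
  have f2 := (h'.local_form (tangentCoordSymm e (x, ξ)) hx'.2 w).trans
    (congrArg₂ (fun A t : E × E => A.2 + Γ' t.1 t.2 A.1)
      (mfderiv_tangentCoord_tangentCoordSymm he he' hx ξ y)
      (tangentCoord_tangentCoordSymm he he' (q := (x, ξ)) hx))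
  dsimp only at f1 f2
  rw [hid.fderiv.fderiv_eq, hid.fderiv_eq, hid.eq_of_nhds, hid2, fderiv_id] at f1
  have f3 := DFunLike.congr_fun (mfderiv_chart_eq_fderiv_transition he he'
    (e.map_target hx'.1) hx'.2) (D (tangentCoordSymm e (x, ξ)) w)
  rw [e.right_inv hx'.1] at f3
  -- The computation produces `D²g(y, ξ)`, while differentiation along a curve needs `D²g(ξ, y)`.
  rw [hsym.eq ξ y]
  refine f2.symm.trans (f3.trans ?_)
  refine (congrArg (fderiv ℝ (e' ∘ e.symm) x) f1).trans ?_
  simp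

end Transition


/-! ### The global connection map -/

section Lift

variable {E : Type*} [NormedAddCommGroup E] [NormedSpace ℝ E]
  {M : Type*} [TopologicalSpace M] [ChartedSpace E M] [IsManifold 𝓘(ℝ, E) ∞ M] {k : ℕ}
  {e : OpenPartialHomeomorph M E}

theorem contMDiff_oscBundle_proj :
    ContMDiff 𝓘(ℝ, Fin (k + 1) → E) 𝓘(ℝ, E) ∞ (OscBundle.proj : OscBundle E M k → M) := by
  intro p
  have he := IsManifold.chart_mem_maximalAtlas (I := 𝓘(ℝ, E)) (n := ∞) p.proj
  have hp : p.proj ∈ (chartAt E p.proj).source := mem_chart_source E _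
  set e := chartAt E p.proj
  have h1 : ContMDiffAt 𝓘(ℝ, Fin (k + 1) → E) 𝓘(ℝ, E) ∞
      (fun q : OscBundle E M k => OscBundle.coord e q 0) p :=
    (ContinuousLinearMap.proj (R := ℝ) (φ := fun _ : Fin (k + 1) => E)
      0).contDiff.contMDiff.contMDiffAt.comp p
        (contMDiffAt_of_mem_maximalAtlas (OscBundle.jetChart_mem_maximalAtlas he) hp)
  have h0 : OscBundle.coord e p 0 ∈ e.target := by
    rw [OscBundle.coord_zero he p hp]; exact e.map_source hp
  refine (((contMDiffOn_symm_of_mem_maximalAtlas he).contMDiffAt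
    (e.open_target.mem_nhds h0)).comp p h1).congr_of_eventuallyEq ?_
  filter_upwards [(OscBundle.jetChart k he).open_source.mem_nhds hp] with q hq
  rw [Function.comp_apply, OscBundle.coord_zero he q hq, e.left_inv hq]

theorem mfderiv_chart_mfderiv_proj (he : e ∈ IsManifold.maximalAtlas 𝓘(ℝ, E) ∞ M)
    (p : OscBundle E M k) (hp : p.proj ∈ e.source)
    (w : TangentSpace 𝓘(ℝ, Fin (k + 1) → E) p) :
    (mfderiv 𝓘(ℝ, E) 𝓘(ℝ, E) e p.proj
      (mfderiv 𝓘(ℝ, Fin (k + 1) → E) 𝓘(ℝ, E) OscBundle.proj p w) : E) =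
    (mfderiv 𝓘(ℝ, Fin (k + 1) → E) 𝓘(ℝ, Fin (k + 1) → E) (OscBundle.coord e) p w :
      Fin (k + 1) → E) 0 := by
  have h1 := mfderiv_comp p ((mdifferentiable_of_mem_maximalAtlas he).mdifferentiableAt hp)
    ((contMDiff_oscBundle_proj p).mdifferentiableAt (by simp))
  have hev : e ∘ OscBundle.proj (k := k) =ᶠ[𝓝 p]
      ContinuousLinearMap.proj (R := ℝ) (φ := fun _ : Fin (k + 1) => E) 0 ∘ OscBundle.coord e := by
    filter_upwards [(OscBundle.jetChart k he).open_source.mem_nhds hp] with q hq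
    exact (OscBundle.coord_zero he q hq).symm
  have h2 := mfderiv_comp p (ContinuousLinearMap.mdifferentiableAt
    (ContinuousLinearMap.proj (R := ℝ) (φ := fun _ : Fin (k + 1) => E) 0))
    (mdifferentiableAt_coord he p hp)
  rw [hev.mfderiv_eq, h2, mfderiv_eq_fderiv, ContinuousLinearMap.fderiv] at h1
  exact (DFunLike.congr_fun h1 w).symm

/-- A local component of a linear connection in a chart. -/
def LinearConnection.localComponent (D : LinearConnection E M)
    (he : e ∈ IsManifold.maximalAtlas 𝓘(ℝ, E) ∞ M) : E → E → E →L[ℝ] E :=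
  (D.exists_localComponent e he).choose

theorem LinearConnection.isLocalComponent (D : LinearConnection E M)
    (he : e ∈ IsManifold.maximalAtlas 𝓘(ℝ, E) ∞ M) :
    IsLocalComponent D.toFun e (D.localComponent he) :=
  (D.exists_localComponent e he).choose_spec

/-- The map `T(TᵏM) → TM` over `πₖ` which in the preferred chart, hence in every chart, reads
`(u; η) ↦ ηᵢ + M¹(u) ηᵢ₋₁ + ⋯ + Mⁱ(u) η₀`. -/
def LinearConnection.covariantJet (D : LinearConnection E M) (i : ℕ) (p : OscBundle E M k) :
    TangentSpace 𝓘(ℝ, Fin (k + 1) → E) p →L[ℝ] TangentSpace 𝓘(ℝ, E) p.proj :=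
  let e := chartAt E p.proj
  let A : E →L[ℝ] TangentSpace 𝓘(ℝ, E) p.proj := (mfderiv 𝓘(ℝ, E) 𝓘(ℝ, E) e p.proj).inverse
  let B : TangentSpace 𝓘(ℝ, Fin (k + 1) → E) p →L[ℝ] (Fin (k + 1) → E) :=
    mfderiv 𝓘(ℝ, Fin (k + 1) → E) 𝓘(ℝ, Fin (k + 1) → E) (OscBundle.coord e) p
  A ∘L covJetCLM (D.localComponent (IsManifold.chart_mem_maximalAtlas p.proj)) i
    (OscBundle.coord e p) ∘L B

/-- Chart independence: the preferred chart in the definition can be replaced by any chart and any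
local component there, because both sides of the formula transform by the derivative of the
transition map. -/
theorem mfderiv_chart_covariantJet (D : LinearConnection E M) {Γ : E → E → E →L[ℝ] E}
    (he : e ∈ IsManifold.maximalAtlas 𝓘(ℝ, E) ∞ M) (hΓ : IsLocalComponent D.toFun e Γ)
    {i : ℕ} (hi : i ≤ k) (p : OscBundle E M k) (hp : p.proj ∈ e.source)
    (w : TangentSpace 𝓘(ℝ, Fin (k + 1) → E) p) :
    (mfderiv 𝓘(ℝ, E) 𝓘(ℝ, E) e p.proj (D.covariantJet i p w) : E) =
      covJetCLM Γ i (OscBundle.coord e p)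
        (mfderiv 𝓘(ℝ, Fin (k + 1) → E) 𝓘(ℝ, Fin (k + 1) → E) (OscBundle.coord e) p w) := by
  have hp₀ : p.proj ∈ (chartAt E p.proj).source := mem_chart_source E _
  have he₀ : chartAt E p.proj ∈ IsManifold.maximalAtlas 𝓘(ℝ, E) ∞ M :=
    IsManifold.chart_mem_maximalAtlas _
  have hΓ₀ := D.isLocalComponent he₀
  unfold LinearConnection.covariantJet
  generalize D.localComponent (IsManifold.chart_mem_maximalAtlas p.proj) = Γ₀ at hΓ₀
  generalize chartAt E p.proj = e₀ at hp₀ he₀ hΓ₀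
  have hso := (e₀.symm.trans e).open_source
  have hg := OscBundle.contDiffOn_transition he₀ he
  have hmaps : MapsTo (e ∘ e₀.symm) (e₀.symm.trans e).source e.target := by
    intro x hx
    have hx' : x ∈ e₀.target ∧ e₀.symm x ∈ e.source := by simpa using hx
    exact e.map_source hx'.2
  have hu := coord_zero_mem_transition_source he₀ p hp₀ hp
  have hcoord : OscBundle.coord e p = jetMap k (e ∘ e₀.symm) (OscBundle.coord e₀ p) :=
    (coord_eventuallyEq he₀ he p hp₀ hp).eq_of_nhds
  have hinv : ∀ x : E, mfderiv 𝓘(ℝ, E) 𝓘(ℝ, E) e₀ p.proj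
      ((mfderiv 𝓘(ℝ, E) 𝓘(ℝ, E) e₀ p.proj).inverse x) = x := by
    intro x
    have hI : (mfderiv 𝓘(ℝ, E) 𝓘(ℝ, E) e₀ p.proj).IsInvertible :=
      ⟨(mdifferentiable_of_mem_maximalAtlas he₀).mfderiv hp₀, rfl⟩
    obtain ⟨A, hA⟩ := hI
    rw [← hA, ContinuousLinearMap.inverse_equiv]
    exact A.apply_symm_apply x
  have key := covJetCLM_jetMap hso e.open_target
    (hΓ₀.contDiffOn.mono (prod_mono_left fun x hx => by
      have hx' : x ∈ e₀.target ∧ e₀.symm x ∈ e.source := by simpa using hx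
      exact hx'.1)) hΓ.contDiffOn hg hmaps
    (fun x hx ξ y => hΓ₀.fderiv_transition he₀ he hΓ hx ξ y) hu
    (mfderiv 𝓘(ℝ, Fin (k + 1) → E) 𝓘(ℝ, Fin (k + 1) → E) (OscBundle.coord e₀) p w) hi
  rw [hcoord, mfderiv_coord_eq_fderiv_jetMap he₀ he p hp₀ hp]
  refine Eq.trans ?_ key.symm
  rw [OscBundle.coord_zero he₀ p hp₀]
  refine (DFunLike.congr_fun (mfderiv_chart_eq_fderiv_transition he₀ he hp₀ hp) _).trans ?_
  exact congrArg (fderiv ℝ (e ∘ e₀.symm) (e₀ p.proj)) (hinv _)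

/-- The preferred chart in the definition changes with the point, so smoothness is checked in the
one chart at `p₀`. There, by chart independence, the operator is `covJetCLM` composed with the
coordinates. -/
theorem contMDiffAt_covariantJet (D : LinearConnection E M) {i : ℕ} (hi : i ≤ k)
    (p₀ : OscBundle E M k) :
    ContMDiffAt 𝓘(ℝ, Fin (k + 1) → E) 𝓘(ℝ, (Fin (k + 1) → E) →L[ℝ] E) ∞
      (inTangentCoordinates 𝓘(ℝ, Fin (k + 1) → E) 𝓘(ℝ, E) (fun p : OscBundle E M k => p)
        OscBundle.proj (fun p => D.covariantJet i p) p₀) p₀ := by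
  have hp₀ : p₀.proj ∈ (chartAt E p₀.proj).source := mem_chart_source E _
  have he : chartAt E p₀.proj ∈ IsManifold.maximalAtlas 𝓘(ℝ, E) ∞ M :=
    IsManifold.chart_mem_maximalAtlas _
  have hΓ := D.isLocalComponent he
  have hchart : chartAt (Fin (k + 1) → E) p₀ = OscBundle.jetChart k he := rfl
  set e := chartAt E p₀.proj
  have hs : IsOpen {u : Fin (k + 1) → E | u 0 ∈ e.target} :=
    e.open_target.preimage (continuous_apply 0)
  have h0 : OscBundle.coord e p₀ 0 ∈ e.target := by
    rw [OscBundle.coord_zero he p₀ hp₀]; exact e.map_source hp₀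
  have h1 : ContMDiffAt 𝓘(ℝ, Fin (k + 1) → E) 𝓘(ℝ, (Fin (k + 1) → E) →L[ℝ] E) ∞
      ((fun u => covJetCLM (D.localComponent he) i u) ∘ OscBundle.coord e) p₀ :=
    ((contDiffOn_covJetCLM e.open_target hΓ.contDiffOn i).contDiffAt
      (hs.mem_nhds h0)).contMDiffAt.comp p₀
        (contMDiffAt_of_mem_maximalAtlas (OscBundle.jetChart_mem_maximalAtlas he) hp₀)
  refine h1.congr_of_eventuallyEq ?_
  filter_upwards [(OscBundle.jetChart k he).open_source.mem_nhds hp₀] with p hp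
  have hd : (OscBundle.jetChart k he).MDifferentiable 𝓘(ℝ, Fin (k + 1) → E)
      𝓘(ℝ, Fin (k + 1) → E) :=
    mdifferentiable_of_mem_maximalAtlas (OscBundle.jetChart_mem_maximalAtlas he)
  have hp' : p.proj ∈ e.source := hp
  have hpc : p ∈ (chartAt (Fin (k + 1) → E) p₀).source := hchart ▸ hp
  refine (inTangentCoordinates_eq_mfderiv_comp (f := fun p : OscBundle E M k => p)
    (g := OscBundle.proj) (ϕ := fun p => D.covariantJet i p) hpc hp').trans ?_
  ext η : 1
  simp only [extChartAt, mfld_simps, mfderivWithin_univ]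
  refine (mfderiv_chart_covariantJet D he hΓ hi p hp _).trans ?_
  refine congrArg (covJetCLM (D.localComponent he) i (OscBundle.coord e p)) ?_
  -- Source coordinates enter through the inverse chart, whose derivative cancels that of `coord e`.
  have h3 := hd.comp_symm_deriv ((OscBundle.jetChart k he).map_source hp)
  rw [(OscBundle.jetChart k he).left_inv hp] at h3
  exact DFunLike.congr_fun h3 η

/-- Smooth dependence of the operators implies smoothness on the total space, by applying them to
the tautological vector `w ↦ w.2`. -/
theorem contMDiff_covariantJet (D : LinearConnection E M) {i : ℕ} (hi : i ≤ k) :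
    ContMDiff 𝓘(ℝ, Fin (k + 1) → E).tangent 𝓘(ℝ, E).tangent ∞
      (fun w : TangentBundle 𝓘(ℝ, Fin (k + 1) → E) (OscBundle E M k) =>
        (⟨w.1.proj, D.covariantJet i w.1 w.2⟩ : TangentBundle 𝓘(ℝ, E) M)) := by
  intro w₀
  have hπ : ContMDiffAt 𝓘(ℝ, Fin (k + 1) → E).tangent 𝓘(ℝ, Fin (k + 1) → E) ∞
      (fun w : TangentBundle 𝓘(ℝ, Fin (k + 1) → E) (OscBundle E M k) => w.1) w₀ :=
    (Bundle.contMDiff_proj (TangentSpace 𝓘(ℝ, Fin (k + 1) → E))).contMDiffAt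
  exact ContMDiffAt.clm_apply_of_inCoordinates
    (b₁ := fun w : TangentBundle 𝓘(ℝ, Fin (k + 1) → E) (OscBundle E M k) => w.1)
    (b₂ := fun w => w.1.proj) (v := fun w => w.2) (ϕ := fun w => D.covariantJet i w.1)
    ((contMDiffAt_covariantJet D hi w₀.1).comp w₀ hπ) contMDiffAt_id
    ((contMDiff_oscBundle_proj w₀.1).comp w₀ hπ)

theorem mfderiv_coord_almostTangent_iterate (he : e ∈ IsManifold.maximalAtlas 𝓘(ℝ, E) ∞ M)
    (p : OscBundle E M k) (hp : p.proj ∈ e.source) (a : ℕ)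
    (w : TangentSpace 𝓘(ℝ, Fin (k + 1) → E) p) :
    mfderiv 𝓘(ℝ, Fin (k + 1) → E) 𝓘(ℝ, Fin (k + 1) → E) (OscBundle.coord e) p
        ((OscBundle.almostTangent p)^[a] w) =
      (shift E k)^[a]
        (mfderiv 𝓘(ℝ, Fin (k + 1) → E) 𝓘(ℝ, Fin (k + 1) → E) (OscBundle.coord e) p w) := by
  induction a with
  | zero => rfl
  | succ a ih =>
    rw [Function.iterate_succ_apply', OscBundle.coord_almostTangent he p hp]
    exact (congrArg (shift E k) ih).trans (Function.iterate_succ_apply' _ _ _).symm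

/-- A chart derivative is injective, so the identity can be tested in one chart, where `J` is the
shift. -/
theorem covariantJet_almostTangent_iterate (D : LinearConnection E M) {i a : ℕ} (h : i + a ≤ k)
    (p : OscBundle E M k) (w : TangentSpace 𝓘(ℝ, Fin (k + 1) → E) p) :
    D.covariantJet (i + a) p ((OscBundle.almostTangent p)^[a] w) = D.covariantJet i p w := by
  have hp : p.proj ∈ (chartAt E p.proj).source := mem_chart_source E _
  have he : chartAt E p.proj ∈ IsManifold.maximalAtlas 𝓘(ℝ, E) ∞ M :=
    IsManifold.chart_mem_maximalAtlas _
  have hΓ := D.isLocalComponent he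
  refine mfderiv_chart_injective he hp ?_
  refine (mfderiv_chart_covariantJet D he hΓ h p hp _).trans
    (Eq.trans ?_ (mfderiv_chart_covariantJet D he hΓ (by omega) p hp w).symm)
  rw [mfderiv_coord_almostTangent_iterate he p hp]
  exact covJetCLM_shift_iterate (E := E) h _ _

theorem covariantJet_zero (D : LinearConnection E M) (p : OscBundle E M k)
    (w : TangentSpace 𝓘(ℝ, Fin (k + 1) → E) p) :
    D.covariantJet 0 p w = mfderiv 𝓘(ℝ, Fin (k + 1) → E) 𝓘(ℝ, E) OscBundle.proj p w := by
  have hp : p.proj ∈ (chartAt E p.proj).source := mem_chart_source E _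
  have he : chartAt E p.proj ∈ IsManifold.maximalAtlas 𝓘(ℝ, E) ∞ M :=
    IsManifold.chart_mem_maximalAtlas _
  refine mfderiv_chart_injective he hp ?_
  refine (mfderiv_chart_covariantJet D he (D.isLocalComponent he) (by omega) p hp w).trans
    (Eq.trans ?_ (mfderiv_chart_mfderiv_proj he p hp w).symm)
  exact covJetCLM_zero (E := E) _ _

/-- The connection map on `TᵏM` induced by a linear connection on `M`. -/
def LinearConnection.connectionMap (D : LinearConnection E M) (k : ℕ) : ConnectionMap E M k where
  toFun p := ContinuousLinearMap.pi fun i => D.covariantJet (i + 1) p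
  contMDiff i := contMDiff_covariantJet D (Nat.succ_le_of_lt i.2)
  contMDiffAt_operator i p₀ := contMDiffAt_covariantJet D (Nat.succ_le_of_lt i.2) p₀
  comp_almostTangent a h1 ha p w := by
    have h := covariantJet_almostTangent_iterate D (i := k - a) (a := a) (by omega) p w
    -- Component number `i` is the covariant jet of order `i + 1`, so index `k - 1` has order `k`
    -- and index `k - a - 1` has order `k - a`.
    have e1 : k - a + a = k - 1 + 1 := by omega
    have e2 : k - a = k - a - 1 + 1 := by omega
    rw [e1] at h
    simp only [ContinuousLinearMap.pi_apply]
    rw [h, ← e2]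
  comp_almostTangent_top hk p w := by
    have h := covariantJet_almostTangent_iterate D (i := 0) (a := k) (by omega) p w
    have e1 : 0 + k = k - 1 + 1 := by omega
    rw [e1, covariantJet_zero] at h
    exact h

theorem hasLocalComponents_connectionMap (D : LinearConnection E M)
    {Γ : E → E → E →L[ℝ] E} (he : e ∈ IsManifold.maximalAtlas 𝓘(ℝ, E) ∞ M)
    (hΓ : IsLocalComponent D.toFun e Γ) :
    (D.connectionMap k).HasLocalComponents e (liftedComponent Γ) where
  contDiffOn a _ := contDiffOn_liftedComponent e.open_target hΓ.contDiffOn a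
  local_form p hp w i :=
    (mfderiv_chart_covariantJet D he hΓ (by omega) p hp w).trans (covJetCLM_succ_apply (E := E) i.2 _ _)

end Lift

end HigherTangent

end

theorem theorem3p3 {E : Type*} [NormedAddCommGroup E] [NormedSpace ℝ E] [CompleteSpace E]
    {M : Type*} [TopologicalSpace M] [ChartedSpace E M] [IsManifold 𝓘(ℝ, E) ∞ M]
    (k : ℕ) (hk : 1 ≤ k) (D : HigherTangent.LinearConnection E M) :
    ∃ K : HigherTangent.ConnectionMap E M k,
      ∀ e ∈ IsManifold.maximalAtlas 𝓘(ℝ, E) ∞ M, ∀ Γ : E → E → E →L[ℝ] E,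
        HigherTangent.IsLocalComponent D.toFun e Γ →
          K.HasLocalComponents e (HigherTangent.liftedComponent Γ) :=
  ⟨D.connectionMap k, fun _ he _ hΓ => HigherTangent.hasLocalComponents_connectionMap D he hΓ⟩
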